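/- Let $p\in(0,1/2)$, let $c_p>0$ be the unique real number with $\mathbb P[Z\le -c_p]=p$ for a standard Gaussian $Z\sim\mathcal N(0,1)$, and let $a=\frac{1}{\sqrt{2\pi}}e^{-c_p^2/2}$. For positive integers $r,d$ let $G(r,d,p)$ be the random graph on $\{1,\dots,r\}$ obtained from independent vectors $\boldsymbol x_1,\dots,\boldsymbol x_r\sim\mathcal N(0,\frac1d I_d)$ in $\mathbb R^d$ by joining distinct $i,j$ exactly when $\langle \boldsymbol x_i,\boldsymbol x_j\rangle\ge -c_p/\sqrt d$. Let $P_{\mathrm{red},r}$ and $P_{\mathrm{blue},r}$ be the probabilities that $G(r,d,p)$ is an independent set, respectively a clique. There are functions $D_0(C)$, $\ell_0(C,D)$, $K(p)$ and $K'(p,C)$ such that the following holds for all real $C>1$, $p\in(0,1/2)$, $D\ge D_0(C)$ and all integers $\ell\ge \ell_0(C,D)$ and $d\ge D^2\ell^2$: $$P_{\mathrm{red},\ell}\le p^{\binom{\ell}{2}}\exp\Big(-\frac{a^3}{p^3\sqrt d}\binom{\ell}{3}\Big(1-\frac{K(p)}{D}\Big)\Big),$$ and, for each positive integer $r$ with $|r-C\ell|<1$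 (that is, $r=C\ell$, or $r$ is $C\ell$ rounded up or down if $C\ell$ is not an integer), $$P_{\mathrm{blue},r}\le (1-p)^{\binom{r}{2}}\exp\Big(\frac{a^3}{(1-p)^3\sqrt d}\binom{r}{3}\Big(1+\frac{K'(p,C)}{D}\Big)\Big).$$ In particular the constants $K(p)$ and $K'(p,C)$ do not depend on $\ell$, $d$ or $D$. -/

import Mathlib

open MeasureTheory ProbabilityTheory

noncomputable section

/-- The Gaussian distribution `N(0, (1/d) I_d)` on `ℝ^d`. -/
def gaussianVector (d : ℕ) : Measure (EuclideanSpace ℝ (Fin d)) :=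
  multivariateGaussian 0 ((1 / (d : ℝ)) • (1 : Matrix (Fin d) (Fin d) ℝ))

/-- The law of `n` independent vectors `x_1, …, x_n` with distribution `N(0, (1/d) I_d)`. -/
def gaussianSample (n d : ℕ) : Measure (Fin n → EuclideanSpace ℝ (Fin d)) :=
  Measure.pi fun _ => gaussianVector d

/-- The geometric graph of the vectors `x_1, …, x_n` with cutoff `c`: distinct vertices `i, j` are
adjacent when `⟨x_i, x_j⟩ ≥ -c / √d`. -/
def geometricGraph {n d : ℕ} (c : ℝ) (x : Fin n → EuclideanSpace ℝ (Fin d)) :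
    SimpleGraph (Fin n) where
  Adj i j := i ≠ j ∧ -c / √(d : ℝ) ≤ inner ℝ (x i) (x j)
  symm := ⟨fun i j h => ⟨h.1.symm, by rw [real_inner_comm]; exact h.2⟩⟩
  loopless := ⟨fun _ h => h.1 rfl⟩

/-- The probability that the random graph on `r` Gaussian vertices is an independent set. -/
def redProb (r d : ℕ) (c : ℝ) : ℝ :=
  (gaussianSample r d).real {x | (geometricGraph c x).IsIndepSet Set.univ}

/-- The probability that the random graph on `r` Gaussian vertices is a clique. -/
def blueProb (r d : ℕ) (c : ℝ) : ℝ :=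
  (gaussianSample r d).real {x | (geometricGraph c x).IsClique Set.univ}

end

/-!
Both probabilities are bounded by orthant probabilities of a Gram matrix: with `σ = -1, τ = c` for the
independent set and `σ = 1, τ = -c` for the clique, the event implies `τ ≤ (σ / √N) ⟨g_i, g_j⟩` for all
`i < j`, where `g_i` are standard Gaussian vectors in `ℝ^N`, `N = d`. Write `q = P(Z ≥ τ)` and let
`κ = φ(τ) / q` be the hazard rate at `τ`, so that `κ = a / p` or `κ = a / (1 - p)`.

The estimate is proved for arbitrary thresholds `t i j` in place of `τ`, by induction on the number
of vectors (`gramProb_le`): the probability is at most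
`q ^ C(n, 2) * exp (κ ∑ (τ - t i j) + σ κ³ C(n, 3) / √N + error)`. Exposing one vector `x₀` splits
the others into their Gaussian coordinates `z_j` along `x₀` and Gaussian vectors in one dimension
less, whose thresholds are shifted by `σ z_j z_k / √N` (`gramProb_succ_succ`). Since the bound
depends on the thresholds through an exponential of fixed slope `κ`, the shift contributes exactly
the weight `exp (σ κ / √N * ∑_{j < k} z_j z_k)`. Under the constraints `z_j ≥ τ` the mean of `z_j`
is `κ`, so that this weight is worth `σ κ³ C(n, 2) / √N`, and summing over the exposed vectors gives
`σ κ³ C(n, 3) / √N`.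

The weighted orthant integral is bounded by decoupling the coordinates: by a Gaussian average of
linear exponentials if `σ = 1`, by a tangent line if `σ = -1`. A linear exponential weight shifts
the thresholds, and log-concavity of the Gaussian tail, that is, monotonicity of its hazard rate,
bounds the effect of such shifts by an exponential of slope `κ` with no error term
(`gaussianTail_le_tangent`). The remaining randomness is the length of `x₀`. It rescales the
thresholds, but the same slope `κ` can be kept at the price of an error linear in `||x₀|² / N - 1|`
(`exists_gaussianReal_real_le_mul_le`), and this is affordable: it costs `O(n / √N)` per vector
(`lintegral_exp_abs_sum_sq_sub_one_le`), hence `O(r² / √N)` altogether, which is smaller than the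
triangle term by a factor of order `r`. The total error `O(r² / √N + r⁴ / N)` is a fraction
`O(1 / D)` of the triangle term as soon as `r ≥ D` and `√N` is at least of order `D r`. When `√N`
is below a constant multiple of `r`, the error exceeds `log (1 / q) * C(r, 2)` and the bound is
trivial. Hence `exists_gramProb_const_le` holds for all `r` and all `N ≥ 1` with a constant depending
on `τ` only, which is what allows the lower bounds on `D` and `ℓ` to be independent of `p`.
-/

/-! ### One-dimensional Gaussian estimates -/

/-- The probability that a standard Gaussian variable is at least `t`. -/
noncomputable def gaussianTail (t : ℝ) : ℝ := (gaussianReal 0 1).real (Set.Ici t)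

/-- The hazard rate `φ(t) / P(Z ≥ t)` of a standard Gaussian variable `Z` with density `φ`. -/
noncomputable def gaussianHazard (t : ℝ) : ℝ := gaussianPDFReal 0 1 t / gaussianTail t

theorem gaussianPDFReal_zero_one (x : ℝ) :
    gaussianPDFReal 0 1 x = (√(2 * Real.pi))⁻¹ * Real.exp (-x ^ 2 / 2) := by
  simp [gaussianPDFReal]

theorem gaussianTail_eq_integral (t : ℝ) :
    gaussianTail t = ∫ x in Set.Ioi t, gaussianPDFReal 0 1 x := by
  rw [gaussianTail, measureReal_def, gaussianReal_apply_eq_integral 0 one_ne_zero,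
    ENNReal.toReal_ofReal, integral_Ici_eq_integral_Ioi]
  exact setIntegral_nonneg measurableSet_Ici fun x _ => gaussianPDFReal_nonneg 0 1 x

theorem gaussianTail_pos (t : ℝ) : 0 < gaussianTail t := by
  rw [gaussianTail, measureReal_def, ENNReal.toReal_pos_iff]
  refine ⟨pos_iff_ne_zero.2 fun h => ?_, measure_lt_top _ _⟩
  have := gaussianReal_absolutelyContinuous' 0 (one_ne_zero (α := NNReal)) h
  simp at this

theorem gaussianTail_le_one (t : ℝ) : gaussianTail t ≤ 1 := measureReal_le_one

theorem gaussianHazard_pos (t : ℝ) : 0 < gaussianHazard t :=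
  div_pos (gaussianPDFReal_pos 0 1 t one_ne_zero) (gaussianTail_pos t)

theorem hasDerivAt_gaussianTail (t : ℝ) :
    HasDerivAt gaussianTail (-gaussianPDFReal 0 1 t) t := by
  have hc : Continuous (gaussianPDFReal 0 1) := by unfold gaussianPDFReal; fun_prop
  have hi := integrable_gaussianPDFReal 0 1
  have h : gaussianTail = fun s => gaussianTail 0 - ∫ x in (0 : ℝ)..s, gaussianPDFReal 0 1 x := by
    funext s
    rw [← intervalIntegral.integral_Ioi_sub_Ioi' hi.integrableOn hi.integrableOn,
      ← gaussianTail_eq_integral, ← gaussianTail_eq_integral]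
    ring
  rw [h]
  simpa using (intervalIntegral.integral_hasDerivAt_right (hc.intervalIntegrable _ _)
    (hc.stronglyMeasurableAtFilter _ _) hc.continuousAt).const_sub (gaussianTail 0)

/-- The hazard rate is monotone: `φ(s + x) / φ(s) = exp (-s x - x² / 2)` decreases in `s` for every
`x ≥ 0`, hence so does the Mills ratio `P(Z ≥ s) / φ(s)`. -/
theorem gaussianHazard_mono {s t : ℝ} (hst : s ≤ t) : gaussianHazard s ≤ gaussianHazard t := by
  have key : gaussianTail t * gaussianPDFReal 0 1 s ≤ gaussianTail s * gaussianPDFReal 0 1 t := by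
    have shift (u : ℝ) : gaussianTail u = ∫ x in Set.Ioi (0 : ℝ), gaussianPDFReal 0 1 (x + u) := by
      have h := (measurePreserving_add_right volume u).setIntegral_preimage_emb
        (measurableEmbedding_addRight u) (gaussianPDFReal 0 1) (Set.Ioi u)
      rw [gaussianTail_eq_integral, ← h]
      simp
    have hint (u : ℝ) : Integrable fun x => gaussianPDFReal 0 1 (x + u) :=
      (integrable_gaussianPDFReal 0 1).comp_add_right u
    rw [shift t, shift s, ← integral_mul_const, ← integral_mul_const]
    refine setIntegral_mono_on ((hint t).mul_const _).integrableOn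
      ((hint s).mul_const _).integrableOn measurableSet_Ioi fun x hx => ?_
    have hx : 0 < x := hx
    simp only [gaussianPDFReal_zero_one]
    rw [mul_mul_mul_comm, mul_mul_mul_comm (√(2 * Real.pi))⁻¹ _ (√(2 * Real.pi))⁻¹,
      ← Real.exp_add, ← Real.exp_add]
    refine mul_le_mul_of_nonneg_left (Real.exp_le_exp.2 ?_) (by positivity)
    nlinarith
  rw [gaussianHazard, gaussianHazard, div_le_div_iff₀ (gaussianTail_pos s) (gaussianTail_pos t)]
  linarith

/-- Log-concavity of the Gaussian tail, in the form of its tangent line at `τ`. -/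
theorem gaussianTail_le_tangent (τ s : ℝ) :
    gaussianTail s ≤ gaussianTail τ * Real.exp (gaussianHazard τ * (τ - s)) := by
  set κ := gaussianHazard τ
  have hd (u : ℝ) : HasDerivAt (fun u => gaussianTail u * Real.exp (κ * u))
      (Real.exp (κ * u) * gaussianTail u * (κ - gaussianHazard u)) u := by
    have h := (hasDerivAt_gaussianTail u).mul ((hasDerivAt_id u).const_mul κ).exp
    have := (gaussianTail_pos u).ne'
    refine h.congr_deriv ?_
    simp only [gaussianHazard, id]
    field_simp
    ring
  have hcont : Continuous fun u => gaussianTail u * Real.exp (κ * u) :=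
    continuous_iff_continuousAt.2 fun u => (hd u).continuousAt
  have main : gaussianTail s * Real.exp (κ * s) ≤ gaussianTail τ * Real.exp (κ * τ) := by
    have hpos (u : ℝ) : 0 < Real.exp (κ * u) * gaussianTail u :=
      mul_pos (Real.exp_pos _) (gaussianTail_pos u)
    rcases le_total s τ with h | h
    · refine monotoneOn_of_deriv_nonneg (convex_Iic τ) hcont.continuousOn
        (fun u _ => (hd u).differentiableAt.differentiableWithinAt) (fun u hu => ?_)
        (Set.mem_Iic.2 h) Set.self_mem_Iic h
      rw [(hd u).deriv]
      rw [interior_Iic] at hu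
      exact mul_nonneg (hpos u).le (sub_nonneg.2 (gaussianHazard_mono (le_of_lt hu)))
    · refine antitoneOn_of_deriv_nonpos (convex_Ici τ) hcont.continuousOn
        (fun u _ => (hd u).differentiableAt.differentiableWithinAt) (fun u hu => ?_)
        Set.self_mem_Ici (Set.mem_Ici.2 h) h
      rw [(hd u).deriv]
      rw [interior_Ici] at hu
      exact mul_nonpos_of_nonneg_of_nonpos (hpos u).le
        (sub_nonpos.2 (gaussianHazard_mono (le_of_lt hu)))
  have h := mul_le_mul_of_nonneg_right main (Real.exp_pos (-(κ * s))).le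
  rw [mul_assoc, mul_assoc, ← Real.exp_add, ← Real.exp_add, add_neg_cancel, Real.exp_zero,
    mul_one] at h
  rwa [mul_sub, sub_eq_add_neg]

theorem gaussianReal_real_le_mul_le_exp {l : ℝ} (hl : 0 ≤ l) (χ t : ℝ) :
    (gaussianReal 0 1).real {z | t ≤ χ * z} ≤ Real.exp (l ^ 2 * χ ^ 2 / 2 - l * t) := by
  have h := measure_ge_le_exp_mul_mgf (X := fun z : ℝ => χ * z) (μ := gaussianReal 0 1) t hl
    (by simpa [mul_assoc] using integrable_exp_mul_gaussianReal (μ := 0) (v := 1) (l * χ))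
  refine h.trans_eq ?_
  have hm : mgf (fun z : ℝ => χ * z) (gaussianReal 0 1) l = Real.exp (l ^ 2 * χ ^ 2 / 2) := by
    rw [mgf_const_mul]
    simp [mgf_fun_id_gaussianReal]
    ring
  rw [hm, ← Real.exp_add]
  ring_nf

/-- The tangent line bound for a Gaussian of standard deviation `χ`: the slope in `t` is the hazard
rate at `τ`, independently of `χ`, and changing `χ` costs at most an error linear in
`|χ² - 1|`. -/
theorem exists_gaussianReal_real_le_mul_le (τ : ℝ) : ∃ M : ℝ, 0 < M ∧ ∀ χ t : ℝ, 0 ≤ χ →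
    (gaussianReal 0 1).real {z | t ≤ χ * z} ≤
      gaussianTail τ * Real.exp (gaussianHazard τ * (τ - t) + M * |χ ^ 2 - 1|) := by
  set κ := gaussianHazard τ with hκ
  have hκ0 : 0 < κ := gaussianHazard_pos τ
  set q := gaussianTail τ with hq
  have hq0 : 0 < q := gaussianTail_pos τ
  have hL : 0 ≤ -Real.log q := by
    have := Real.log_nonpos hq0.le (gaussianTail_le_one τ)
    linarith
  set L := -Real.log q + κ * |τ| with hLdef
  have hqL : q = Real.exp (Real.log q) := (Real.exp_log hq0).symm
  have hLτ : -L ≤ Real.log q + κ * τ := by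
    have := mul_le_mul_of_nonneg_left (neg_abs_le τ) hκ0.le
    rw [hLdef]; linarith
  have hL0 : 0 ≤ L := by positivity
  -- beyond `U` the Chernoff bound with parameter `2κ` beats the tangent line of slope `3κ/2`
  set U := 2 * (2 * κ ^ 2 + L) / κ with hU
  have hUκ : κ * U = 2 * (2 * κ ^ 2 + L) := by rw [hU]; field_simp
  have hU0 : 0 ≤ U := by positivity
  refine ⟨3 * κ ^ 2 + 2 * L + κ * U, by positivity, fun χ t hχ => ?_⟩
  set w := |χ ^ 2 - 1| with hw
  have hw0 : 0 ≤ w := abs_nonneg _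
  rcases le_total (1 / 2) w with hw2 | hw2
  · refine (gaussianReal_real_le_mul_le_exp hκ0.le χ t).trans ?_
    rw [hqL, ← Real.exp_add, Real.exp_le_exp]
    have h1 : χ ^ 2 ≤ 1 + w := by have := le_abs_self (χ ^ 2 - 1); linarith
    have h2 : κ ^ 2 * χ ^ 2 ≤ κ ^ 2 * (1 + w) := mul_le_mul_of_nonneg_left h1 (by positivity)
    nlinarith [mul_nonneg hL0 (sub_nonneg.2 hw2), mul_nonneg (sq_nonneg κ) (sub_nonneg.2 hw2),
      mul_nonneg (mul_nonneg hκ0.le hU0) hw0]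
  · have hχ0 : 0 < χ := by
      have := neg_abs_le (χ ^ 2 - 1)
      nlinarith
    have hχw : |χ - 1| ≤ w := by
      have : w = |χ - 1| * (χ + 1) := by
        rw [hw, ← abs_of_pos (by linarith : 0 < χ + 1), ← abs_mul]
        ring_nf
      rw [this]
      exact le_mul_of_one_le_right (abs_nonneg _) (by linarith)
    obtain ⟨hχ1, hχ2⟩ := abs_le.1 hχw
    obtain ⟨s, rfl⟩ : ∃ s, t = χ * s := ⟨t / χ, by field_simp⟩
    have hset : {z | χ * s ≤ χ * z} = Set.Ici s := by
      ext z; simp [mul_le_mul_iff_right₀ hχ0]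
    have hrw : (gaussianReal 0 1).real {z | χ * s ≤ χ * z} = gaussianTail s := by
      rw [hset, gaussianTail]
    rcases lt_or_ge U |s| with hs | hs
    · have hA : 0 ≤ (3 * κ ^ 2 + 2 * L + κ * U) * w := by positivity
      have hκs : 2 * (2 * κ ^ 2 + L) ≤ κ * |s| := by
        rw [← hUκ]; exact mul_le_mul_of_nonneg_left hs.le hκ0.le
      rcases le_total 0 s with h0 | h0
      · rw [abs_of_nonneg h0] at hκs
        have h := gaussianReal_real_le_mul_le_exp (l := 2 * κ) (by positivity) 1 s
        have hset' : {z : ℝ | s ≤ 1 * z} = Set.Ici s := by ext; simp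
        rw [hset'] at h
        rw [hrw]
        refine h.trans ?_
        rw [hqL, ← Real.exp_add, Real.exp_le_exp]
        have : χ * (κ * s) ≤ 3 / 2 * (κ * s) :=
          mul_le_mul_of_nonneg_right (by linarith) (by positivity)
        nlinarith
      · rw [abs_of_nonpos h0] at hκs
        rw [hrw]
        refine (gaussianTail_le_one s).trans ?_
        rw [hqL, ← Real.exp_add, Real.one_le_exp_iff]
        have : 1 / 2 * (κ * -s) ≤ χ * (κ * -s) :=
          mul_le_mul_of_nonneg_right (by linarith) (mul_nonneg hκ0.le (by linarith))
        nlinarith [sq_nonneg κ]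
    · rw [hrw]
      refine (gaussianTail_le_tangent τ s).trans ?_
      rw [← hκ, ← hq]
      refine mul_le_mul_of_nonneg_left (Real.exp_le_exp.2 ?_) hq0.le
      have h1 : (χ - 1) * s ≤ w * U := by
        refine (le_abs_self _).trans ?_
        rw [abs_mul]
        exact mul_le_mul hχw hs (abs_nonneg _) hw0
      have h2 := mul_le_mul_of_nonneg_left h1 hκ0.le
      nlinarith [mul_nonneg (sq_nonneg κ) hw0, mul_nonneg hL0 hw0]

/-- Completing the square: a quadratic exponential weight turns the standard Gaussian into the
Gaussian of mean `l / (1 - δ)` and variance `1 / (1 - δ)`, up to normalization. -/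
theorem lintegral_mul_exp_gaussianReal {δ : ℝ} (hδ : δ < 1) (l : ℝ) {f : ℝ → ENNReal}
    (hf : Measurable f) :
    ∫⁻ z, f z * ENNReal.ofReal (Real.exp (l * z + δ / 2 * z ^ 2)) ∂(gaussianReal 0 1) =
      ENNReal.ofReal (Real.exp (l ^ 2 / (2 * (1 - δ))) / √(1 - δ)) *
        ∫⁻ z, f (z / √(1 - δ) + l / (1 - δ)) ∂(gaussianReal 0 1) := by
  have h1 : 0 < 1 - δ := by linarith
  obtain ⟨v, hv⟩ : ∃ v : NNReal, (v : ℝ) = (1 - δ)⁻¹ :=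
    ⟨_, Real.coe_toNNReal _ (inv_pos.2 h1).le⟩
  have hv0 : v ≠ 0 := by
    rw [← NNReal.coe_ne_zero, hv]
    exact (inv_pos.2 h1).ne'
  have hmap : (gaussianReal 0 1).map (fun z => z / √(1 - δ) + l / (1 - δ)) =
      gaussianReal (l / (1 - δ)) v := by
    have := Measure.map_map (μ := gaussianReal 0 1) (f := fun z : ℝ => z / √(1 - δ))
      (g := fun z => z + l / (1 - δ)) (by fun_prop) (by fun_prop)
    rw [Function.comp_def] at this
    rw [← this, gaussianReal_map_div_const, gaussianReal_map_add_const]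
    congr 1
    · simp
    · ext
      simp [hv, Real.sq_sqrt h1.le]
  have hL : ∫⁻ z, f (z / √(1 - δ) + l / (1 - δ)) ∂(gaussianReal 0 1) =
      ∫⁻ z, f z ∂(gaussianReal (l / (1 - δ)) v) := by
    rw [← hmap, lintegral_map hf (by fun_prop)]
  rw [hL, gaussianReal_of_var_ne_zero _ one_ne_zero, gaussianReal_of_var_ne_zero _ hv0,
    lintegral_withDensity_eq_lintegral_mul _ (measurable_gaussianPDF _ _) (by fun_prop),
    lintegral_withDensity_eq_lintegral_mul _ (measurable_gaussianPDF _ _) hf,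
    ← lintegral_const_mul _ (by fun_prop)]
  refine lintegral_congr fun z => ?_
  simp only [Pi.mul_apply, gaussianPDF]
  rw [mul_comm (f z), ← mul_assoc, ← mul_assoc, ← ENNReal.ofReal_mul (gaussianPDFReal_nonneg _ _ _),
    ← ENNReal.ofReal_mul (by positivity)]
  congr 2
  simp only [gaussianPDFReal, hv, NNReal.coe_one, mul_one]
  have hs : √(2 * Real.pi * (1 - δ)⁻¹) = √(2 * Real.pi) / √(1 - δ) := by
    rw [← div_eq_mul_inv, Real.sqrt_div (by positivity)]
  rw [hs]
  have h2 : 0 < √(1 - δ) := Real.sqrt_pos.2 h1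
  have h3 : 0 < √(2 * Real.pi) := Real.sqrt_pos.2 (by positivity)
  have hexp : Real.exp (-(z - 0) ^ 2 / 2) * Real.exp (l * z + δ / 2 * z ^ 2) =
      Real.exp (l ^ 2 / (2 * (1 - δ))) *
        Real.exp (-(z - l / (1 - δ)) ^ 2 / (2 * (1 - δ)⁻¹)) := by
    rw [← Real.exp_add, ← Real.exp_add]
    congr 1
    field_simp
    ring
  calc _ = (√(2 * Real.pi))⁻¹ *
        (Real.exp (-(z - 0) ^ 2 / 2) * Real.exp (l * z + δ / 2 * z ^ 2)) := by ring
    _ = _ := by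
      rw [hexp]
      field_simp

/-! ### Tilted orthant probabilities -/

theorem lintegral_fin_prod_eq_prod {α : Type*} [MeasurableSpace α] (μ : Measure α) [SigmaFinite μ]
    {n : ℕ} {f : Fin n → α → ENNReal} (hf : ∀ i, Measurable (f i)) :
    ∫⁻ x : Fin n → α, ∏ i, f i (x i) ∂(Measure.pi fun _ => μ) = ∏ i, ∫⁻ a, f i a ∂μ := by
  induction n with
  | zero => simp
  | succ n ih =>
    have h := (measurePreserving_piFinSuccAbove (fun _ : Fin (n + 1) => μ) 0)
    have hm : Measurable fun x : Fin n → α => ∏ i, f i.succ (x i) :=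
      Finset.measurable_fun_prod _ fun i _ => (hf i.succ).comp (measurable_pi_apply i)
    have hsplit := h.lintegral_comp
      (f := fun y : α × (Fin n → α) => f 0 y.1 * ∏ i, f i.succ (y.2 i))
      (((hf 0).comp measurable_fst).mul (hm.comp measurable_snd))
    simp only [MeasurableEquiv.piFinSuccAbove_apply, Fin.insertNthEquiv_zero,
      Fin.consEquiv_symm_apply] at hsplit
    simp only [Fin.prod_univ_succ]
    rw [← ih fun i => hf i.succ]
    refine Eq.trans ?_ (hsplit.trans (lintegral_prod_mul (hf 0).aemeasurable hm.aemeasurable))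
    rfl

theorem sum_Ioi_mul_eq {n : ℕ} (z : Fin n → ℝ) :
    ∑ i, ∑ j ∈ Finset.Ioi i, z i * z j = ((∑ i, z i) ^ 2 - ∑ i, z i ^ 2) / 2 := by
  induction n with
  | zero => simp
  | succ n ih =>
    simp only [Fin.sum_univ_succ, Fin.sum_Ioi_zero, Fin.sum_Ioi_succ, ih fun i => z i.succ]
    rw [← Finset.mul_sum]
    ring

theorem one_div_sqrt_one_sub_le_exp_add_sq {x : ℝ} (h1 : x ≤ 1 / 2) :
    1 / √(1 - x) ≤ Real.exp (x / 2 + x ^ 2) := by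
  have hx : 0 < 1 - x := by linarith
  have h := Real.add_one_le_exp (((2 : ℕ) : ℝ) * (x / 2 + x ^ 2))
  rw [Real.exp_nat_mul] at h
  push_cast at h
  rw [div_le_iff₀ (Real.sqrt_pos.2 hx), ← Real.sqrt_sq (Real.exp_pos _).le,
    ← Real.sqrt_mul (by positivity), Real.one_le_sqrt]
  nlinarith [mul_le_mul_of_nonneg_right h hx.le, mul_nonneg (sq_nonneg x) (sub_nonneg.2 h1)]

theorem one_div_sqrt_one_sub_le_exp {x : ℝ} (h0 : 0 ≤ x) (h1 : x ≤ 1 / 2) :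
    1 / √(1 - x) ≤ Real.exp x :=
  (one_div_sqrt_one_sub_le_exp_add_sq h1).trans (Real.exp_le_exp.2 (by nlinarith))

theorem lintegral_exp_gaussianReal {δ : ℝ} (hδ : δ < 1) (l : ℝ) :
    ∫⁻ z, ENNReal.ofReal (Real.exp (l * z + δ / 2 * z ^ 2)) ∂(gaussianReal 0 1) =
      ENNReal.ofReal (Real.exp (l ^ 2 / (2 * (1 - δ))) / √(1 - δ)) := by
  simpa using lintegral_mul_exp_gaussianReal hδ l (f := fun _ => 1) measurable_const

section Orthant

variable {τ M : ℝ}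

/-- One coordinate. The hypothesis `hM`, here and below, is the conclusion of
`exists_gaussianReal_real_le_mul_le` for a fixed constant `M`. -/
theorem lintegral_indicator_mul_exp_le
    (hM : ∀ χ t : ℝ, 0 ≤ χ → (gaussianReal 0 1).real {z | t ≤ χ * z} ≤
      gaussianTail τ * Real.exp (gaussianHazard τ * (τ - t) + M * |χ ^ 2 - 1|))
    {χ δ : ℝ} (hχ : 0 ≤ χ) (hδ : δ < 1) (l t : ℝ) :
    ∫⁻ z, {z | t ≤ χ * z}.indicator 1 z *
        ENNReal.ofReal (Real.exp (l * z + δ / 2 * z ^ 2)) ∂(gaussianReal 0 1) ≤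
      ENNReal.ofReal (gaussianTail τ * (1 / √(1 - δ)) *
        Real.exp (l ^ 2 / (2 * (1 - δ)) + gaussianHazard τ * (τ - t + χ * l / (1 - δ)) +
          M * |χ ^ 2 / (1 - δ) - 1|)) := by
  have h1 : 0 < 1 - δ := by linarith
  have hms : MeasurableSet {z | t ≤ χ * z} :=
    measurableSet_le measurable_const (by fun_prop)
  rw [lintegral_mul_exp_gaussianReal hδ l (measurable_one.indicator hms)]
  have hset : ∀ z : ℝ, {z | t ≤ χ * z}.indicator (1 : ℝ → ENNReal) (z / √(1 - δ) + l / (1 - δ)) =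
      {z | t - χ * l / (1 - δ) ≤ χ / √(1 - δ) * z}.indicator 1 z := by
    intro z
    have : t ≤ χ * (z / √(1 - δ) + l / (1 - δ)) ↔
        t - χ * l / (1 - δ) ≤ χ / √(1 - δ) * z := by
      rw [sub_le_iff_le_add]
      ring_nf
    simp only [Set.indicator, Set.mem_ofPred_eq, this, Pi.one_apply]
  simp only [hset]
  rw [lintegral_indicator_one (measurableSet_le measurable_const (by fun_prop)),
    ← ENNReal.ofReal_toReal (measure_ne_top (gaussianReal 0 1) _), ← measureReal_def,
    ← ENNReal.ofReal_mul (by positivity)]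
  refine ENNReal.ofReal_le_ofReal ?_
  have h := hM (χ / √(1 - δ)) (t - χ * l / (1 - δ)) (by positivity)
  rw [div_pow, Real.sq_sqrt h1.le] at h
  refine (mul_le_mul_of_nonneg_left h (by positivity)).trans_eq ?_
  rw [add_assoc, Real.exp_add, show τ - t + χ * l / (1 - δ) = τ - (t - χ * l / (1 - δ)) by ring,
    div_eq_mul_one_div (Real.exp (l ^ 2 / (2 * (1 - δ))))]
  simp only [Real.exp_add]
  ac_rfl

theorem indicator_forall_eq_prod {n : ℕ} (t z : Fin n → ℝ) (χ : ℝ) :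
    {z : Fin n → ℝ | ∀ j, t j ≤ χ * z j}.indicator (1 : (Fin n → ℝ) → ENNReal) z =
      ∏ j, {a : ℝ | t j ≤ χ * a}.indicator 1 (z j) := by
  classical
  by_cases h : ∀ j, t j ≤ χ * z j
  · rw [Set.indicator_of_mem (by exact h), Finset.prod_eq_one fun j _ => ?_]
    · rfl
    · rw [Set.indicator_of_mem (by exact h j)]; rfl
  · rw [Set.indicator_of_notMem (by exact h)]
    push Not at h
    obtain ⟨j, hj⟩ := h
    rw [Finset.prod_eq_zero (Finset.mem_univ j)]
    rw [Set.indicator_of_notMem]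
    simpa using hj

theorem lintegral_indicator_mul_exp_sum_le
    (hM : ∀ χ t : ℝ, 0 ≤ χ → (gaussianReal 0 1).real {z | t ≤ χ * z} ≤
      gaussianTail τ * Real.exp (gaussianHazard τ * (τ - t) + M * |χ ^ 2 - 1|))
    {χ δ : ℝ} (hχ : 0 ≤ χ) (hδ : δ < 1) (l : ℝ) {n : ℕ} (t : Fin n → ℝ) :
    ∫⁻ z, {z : Fin n → ℝ | ∀ j, t j ≤ χ * z j}.indicator 1 z *
        ENNReal.ofReal (Real.exp (l * ∑ j, z j + δ / 2 * ∑ j, z j ^ 2))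
          ∂(Measure.pi fun _ => gaussianReal 0 1) ≤
      ENNReal.ofReal (gaussianTail τ ^ n * (1 / √(1 - δ)) ^ n *
        Real.exp (gaussianHazard τ * ∑ j, (τ - t j) +
          n * (l ^ 2 / (2 * (1 - δ)) + gaussianHazard τ * (χ * l / (1 - δ)) +
            M * |χ ^ 2 / (1 - δ) - 1|))) := by
  have hq := gaussianTail_pos τ
  have h1 : 0 < 1 - δ := by linarith
  have hrw : ∀ z : Fin n → ℝ, {z : Fin n → ℝ | ∀ j, t j ≤ χ * z j}.indicator 1 z *
        ENNReal.ofReal (Real.exp (l * ∑ j, z j + δ / 2 * ∑ j, z j ^ 2)) =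
      ∏ j, ({a : ℝ | t j ≤ χ * a}.indicator 1 (z j) *
        ENNReal.ofReal (Real.exp (l * z j + δ / 2 * z j ^ 2))) := by
    intro z
    rw [Finset.prod_mul_distrib, ← indicator_forall_eq_prod,
      ← ENNReal.ofReal_prod_of_nonneg fun _ _ => (Real.exp_pos _).le, ← Real.exp_sum,
      Finset.sum_add_distrib, Finset.mul_sum, Finset.mul_sum]
  simp only [hrw]
  rw [lintegral_fin_prod_eq_prod (gaussianReal 0 1)
    (f := fun j a => {a : ℝ | t j ≤ χ * a}.indicator 1 a *
      ENNReal.ofReal (Real.exp (l * a + δ / 2 * a ^ 2)))]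
  · refine (Finset.prod_le_prod' fun j _ => lintegral_indicator_mul_exp_le hM hχ hδ l (t j)).trans ?_
    rw [← ENNReal.ofReal_prod_of_nonneg fun _ _ => by positivity]
    refine ENNReal.ofReal_le_ofReal (le_of_eq ?_)
    rw [Finset.prod_mul_distrib, ← Real.exp_sum]
    simp only [Finset.prod_const, Finset.card_univ, Fintype.card_fin, mul_pow]
    congr 2
    simp only [Finset.sum_add_distrib, mul_add, Finset.mul_sum, Finset.sum_const,
      Finset.card_univ, Fintype.card_fin, nsmul_eq_mul]
    ring
  · intro j
    exact (measurable_one.indicator (measurableSet_le measurable_const (by fun_prop))).mul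
      (by fun_prop)

/-- The case of a positive coupling. The weight `exp (ε S² / 2)`, `S = ∑ z_j`, is the average of
`exp (√ε h S)` over a standard Gaussian `h`, and for fixed `h` the coordinates are independent. -/
theorem lintegral_indicator_mul_exp_pairs_le_of_pos (hM0 : 0 ≤ M)
    (hM : ∀ χ t : ℝ, 0 ≤ χ → (gaussianReal 0 1).real {z | t ≤ χ * z} ≤
      gaussianTail τ * Real.exp (gaussianHazard τ * (τ - t) + M * |χ ^ 2 - 1|))
    {χ ε : ℝ} (hχ : 0 ≤ χ) (hε : 0 ≤ ε) {n : ℕ} (hn : n * ε ≤ 1 / 2) (t : Fin n → ℝ) :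
    ∫⁻ z, {z : Fin n → ℝ | ∀ j, t j ≤ χ * z j}.indicator 1 z *
        ENNReal.ofReal (Real.exp (ε * ∑ i, ∑ j ∈ Finset.Ioi i, z i * z j))
          ∂(Measure.pi fun _ => gaussianReal 0 1) ≤
      ENNReal.ofReal (gaussianTail τ ^ n *
        Real.exp (gaussianHazard τ * ∑ j, (τ - t j) + ε * gaussianHazard τ ^ 2 * (n ^ 2 / 2) +
          (M + gaussianHazard τ ^ 2 + 1) * (n * |χ ^ 2 - 1| + n * ε + n ^ 3 * ε ^ 2))) := by
  have hq := gaussianTail_pos τ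
  set κ := gaussianHazard τ with hκ
  set w := |χ ^ 2 - 1| with hw
  have hw0 : 0 ≤ w := abs_nonneg _
  set A : Set (Fin n → ℝ) := {z | ∀ j, t j ≤ χ * z j} with hA
  have hAm : MeasurableSet A := by
    rw [hA, Set.ofPred_forall]
    exact MeasurableSet.iInter fun j => measurableSet_le measurable_const (by fun_prop)
  set I : (Fin n → ℝ) → ENNReal := A.indicator 1 with hI
  have hIm : Measurable I := measurable_one.indicator hAm
  have hlin : ∀ z : Fin n → ℝ,
      I z * ENNReal.ofReal (Real.exp (ε * ∑ i, ∑ j ∈ Finset.Ioi i, z i * z j)) ≤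
      ∫⁻ h, I z * ENNReal.ofReal (Real.exp (√ε * h * ∑ j, z j)) ∂(gaussianReal 0 1) := by
    intro z
    have h := lintegral_exp_gaussianReal zero_lt_one (√ε * ∑ j, z j)
    rw [lintegral_const_mul _ (by fun_prop)]
    refine mul_le_mul_right ?_ _
    have hl : ∫⁻ h, ENNReal.ofReal (Real.exp (√ε * h * ∑ j, z j)) ∂(gaussianReal 0 1) =
        ENNReal.ofReal (Real.exp (ε * (∑ j, z j) ^ 2 / 2)) := by
      rw [mul_pow, Real.sq_sqrt hε] at h
      simp only [zero_div, zero_mul, add_zero, sub_zero, mul_one, Real.sqrt_one, div_one] at h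
      rw [← h]
      refine lintegral_congr fun x => ?_
      ring_nf
    rw [hl]
    refine ENNReal.ofReal_le_ofReal (Real.exp_le_exp.2 ?_)
    rw [sum_Ioi_mul_eq]
    have : 0 ≤ ε * ∑ j, z j ^ 2 := mul_nonneg hε (Finset.sum_nonneg fun _ _ => sq_nonneg _)
    nlinarith
  refine (lintegral_mono hlin).trans ?_
  rw [lintegral_lintegral_swap (by
    refine Measurable.aemeasurable ?_
    exact (hIm.comp measurable_fst).mul (by fun_prop))]
  have hcond : ∀ h : ℝ, ∫⁻ z, I z * ENNReal.ofReal (Real.exp (√ε * h * ∑ j, z j))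
        ∂(Measure.pi fun _ => gaussianReal 0 1) ≤
      ENNReal.ofReal (gaussianTail τ ^ n * Real.exp (κ * ∑ j, (τ - t j) + n * (M * w))) *
        ENNReal.ofReal (Real.exp (n * κ * χ * √ε * h + n * ε / 2 * h ^ 2)) := by
    intro h
    have h2 := lintegral_indicator_mul_exp_sum_le hM hχ zero_lt_one (√ε * h) t
    simp only [zero_div, zero_mul, add_zero, sub_zero, mul_one, Real.sqrt_one, div_one,
      one_pow] at h2
    refine h2.trans (le_of_eq ?_)
    rw [← ENNReal.ofReal_mul (by positivity), mul_assoc, ← Real.exp_add, mul_pow, Real.sq_sqrt hε]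
    congr 3
    ring
  refine (lintegral_mono hcond).trans ?_
  rw [lintegral_const_mul _ (by fun_prop), lintegral_exp_gaussianReal (by linarith),
    ← ENNReal.ofReal_mul (by positivity)]
  refine ENNReal.ofReal_le_ofReal ?_
  rw [mul_assoc]
  refine mul_le_mul_of_nonneg_left ?_ (by positivity)
  have hnε : 0 ≤ n * ε := by positivity
  have h5 := one_div_sqrt_one_sub_le_exp hnε hn
  rw [div_eq_mul_one_div (Real.exp _) (√_)]
  refine (mul_le_mul_of_nonneg_left (mul_le_mul_of_nonneg_left h5 (Real.exp_pos _).le)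
    (Real.exp_pos _).le).trans ?_
  rw [← Real.exp_add, ← Real.exp_add, Real.exp_le_exp]
  have hmul : (n * κ * χ * √ε) ^ 2 = n ^ 2 * κ ^ 2 * χ ^ 2 * ε := by
    rw [mul_pow, Real.sq_sqrt hε]; ring
  rw [hmul]
  have hχ2 : χ ^ 2 ≤ 1 + w := by have := le_abs_self (χ ^ 2 - 1); linarith
  have h6 : n ^ 2 * κ ^ 2 * χ ^ 2 * ε / (2 * (1 - n * ε)) ≤
      n ^ 2 * κ ^ 2 * (1 + w) * ε * (1 + 2 * (n * ε)) / 2 := by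
    have h7 : n ^ 2 * κ ^ 2 * χ ^ 2 * ε ≤ n ^ 2 * κ ^ 2 * (1 + w) * ε := by gcongr
    rw [div_le_div_iff₀ (by linarith) two_pos]
    have h8 : 1 ≤ (1 + 2 * (n * ε)) * (1 - n * ε) := by nlinarith
    have h9 : 0 ≤ n ^ 2 * κ ^ 2 * (1 + w) * ε := by positivity
    nlinarith [mul_le_mul_of_nonneg_left h8 h9]
  have h10 : n ^ 2 * κ ^ 2 * w * ε * (1 + 2 * (n * ε)) / 2 ≤ n * κ ^ 2 * w := by
    have : n * ε * (1 + 2 * (n * ε)) / 2 ≤ 1 := by nlinarith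
    have h11 : 0 ≤ n * κ ^ 2 * w := by positivity
    nlinarith [mul_le_mul_of_nonneg_left this h11]
  have h12 : 0 ≤ n * w := by positivity
  have h13 : 0 ≤ n ^ 3 * ε ^ 2 := by positivity
  have e1 : 0 ≤ M * (n * ε) := by positivity
  have e2 : 0 ≤ M * (n ^ 3 * ε ^ 2) := by positivity
  have e3 : 0 ≤ κ ^ 2 * (n * ε) := by positivity
  nlinarith

/-- The case of a negative coupling. Here `-ε S² / 2` lies below its tangent line at the typical
value `n κ` of `S = ∑ z_j`, so that the coordinates decouple at once. -/
theorem lintegral_indicator_mul_exp_pairs_le_of_neg (hM0 : 0 ≤ M)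
    (hM : ∀ χ t : ℝ, 0 ≤ χ → (gaussianReal 0 1).real {z | t ≤ χ * z} ≤
      gaussianTail τ * Real.exp (gaussianHazard τ * (τ - t) + M * |χ ^ 2 - 1|))
    {χ ε : ℝ} (hχ : 0 ≤ χ) (hε : 0 ≤ ε) (hε2 : ε ≤ 1 / 2) {n : ℕ} (hn : n * ε ≤ 1 / 2)
    (t : Fin n → ℝ) :
    ∫⁻ z, {z : Fin n → ℝ | ∀ j, t j ≤ χ * z j}.indicator 1 z *
        ENNReal.ofReal (Real.exp (-ε * ∑ i, ∑ j ∈ Finset.Ioi i, z i * z j))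
          ∂(Measure.pi fun _ => gaussianReal 0 1) ≤
      ENNReal.ofReal (gaussianTail τ ^ n *
        Real.exp (gaussianHazard τ * ∑ j, (τ - t j) + -ε * gaussianHazard τ ^ 2 * (n ^ 2 / 2) +
          (2 * M + gaussianHazard τ ^ 2 + 1) * (n * |χ ^ 2 - 1| + n * ε + n ^ 3 * ε ^ 2))) := by
  have hq := gaussianTail_pos τ
  set κ := gaussianHazard τ with hκ
  have hκ0 : 0 < κ := gaussianHazard_pos τ
  set w := |χ ^ 2 - 1| with hw
  have hw0 : 0 ≤ w := abs_nonneg _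
  have h1 : 0 < 1 - ε := by linarith
  have hpt : ∀ z : Fin n → ℝ, {z : Fin n → ℝ | ∀ j, t j ≤ χ * z j}.indicator 1 z *
        ENNReal.ofReal (Real.exp (-ε * ∑ i, ∑ j ∈ Finset.Ioi i, z i * z j)) ≤
      ENNReal.ofReal (Real.exp (ε * (n * κ) ^ 2 / 2)) *
        ({z : Fin n → ℝ | ∀ j, t j ≤ χ * z j}.indicator 1 z *
        ENNReal.ofReal (Real.exp (-(ε * (n * κ)) * ∑ j, z j + ε / 2 * ∑ j, z j ^ 2))) := by
    intro z
    rw [mul_left_comm, ← ENNReal.ofReal_mul (by positivity), ← Real.exp_add]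
    refine mul_le_mul_right (ENNReal.ofReal_le_ofReal (Real.exp_le_exp.2 ?_)) _
    rw [sum_Ioi_mul_eq]
    nlinarith [mul_nonneg hε (sq_nonneg (∑ j, z j - n * κ))]
  refine (lintegral_mono hpt).trans ?_
  rw [lintegral_const_mul' _ _ ENNReal.ofReal_ne_top]
  refine (mul_le_mul_right (lintegral_indicator_mul_exp_sum_le hM hχ (by linarith)
    (-(ε * (n * κ))) t) _).trans ?_
  rw [← ENNReal.ofReal_mul (by positivity), ← hκ]
  refine ENNReal.ofReal_le_ofReal ?_
  have h5 : (1 / √(1 - ε)) ^ n ≤ Real.exp (n * ε) := by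
    rw [Real.exp_nat_mul]
    exact pow_le_pow_left₀ (by positivity) (one_div_sqrt_one_sub_le_exp hε hε2) n
  calc _ = gaussianTail τ ^ n * ((1 / √(1 - ε)) ^ n * (Real.exp (ε * (n * κ) ^ 2 / 2) *
        Real.exp (κ * ∑ j, (τ - t j) + n * ((-(ε * (n * κ))) ^ 2 / (2 * (1 - ε)) +
          κ * (χ * -(ε * (n * κ)) / (1 - ε)) + M * |χ ^ 2 / (1 - ε) - 1|)))) := by ring
    _ ≤ gaussianTail τ ^ n * (Real.exp (n * ε) * (Real.exp (ε * (n * κ) ^ 2 / 2) *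
        Real.exp (κ * ∑ j, (τ - t j) + n * ((-(ε * (n * κ))) ^ 2 / (2 * (1 - ε)) +
          κ * (χ * -(ε * (n * κ)) / (1 - ε)) + M * |χ ^ 2 / (1 - ε) - 1|)))) := by gcongr
    _ ≤ _ := by
      refine mul_le_mul_of_nonneg_left ?_ (by positivity)
      rw [← Real.exp_add, ← Real.exp_add, Real.exp_le_exp]
      have a1 : (-(ε * (n * κ))) ^ 2 / (2 * (1 - ε)) ≤ ε ^ 2 * n ^ 2 * κ ^ 2 := by
        rw [div_le_iff₀ (by linarith)]
        have : 0 ≤ ε ^ 2 * n ^ 2 * κ ^ 2 := by positivity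
        nlinarith
      have hχw : 1 - w ≤ χ := by
        have h3 := neg_abs_le (χ ^ 2 - 1)
        by_contra hcon
        push Not at hcon
        nlinarith
      have a2 : κ * (χ * -(ε * (n * κ)) / (1 - ε)) ≤ -(ε * n * κ ^ 2) + ε * n * κ ^ 2 * w := by
        have h4 : 0 ≤ ε * n * κ ^ 2 := by positivity
        have h6 : ε * n * κ ^ 2 * χ ≤ ε * n * κ ^ 2 * χ / (1 - ε) := by
          rw [le_div_iff₀ h1]
          have : 0 ≤ ε * n * κ ^ 2 * χ := by positivity
          nlinarith
        have h7 : κ * (χ * -(ε * (n * κ)) / (1 - ε)) = -(ε * n * κ ^ 2 * χ / (1 - ε)) := by ring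
        rw [h7]
        nlinarith
      have a3 : |χ ^ 2 / (1 - ε) - 1| ≤ 2 * w + 2 * ε := by
        have h8 : χ ^ 2 / (1 - ε) - 1 = ((χ ^ 2 - 1) + ε) / (1 - ε) := by field_simp; ring
        rw [h8, abs_div, abs_of_pos h1, div_le_iff₀ h1]
        have h9 : |χ ^ 2 - 1 + ε| ≤ w + ε := (abs_add_le _ _).trans (by rw [abs_of_nonneg hε])
        nlinarith
      have hn0 : (0 : ℝ) ≤ n := Nat.cast_nonneg n
      have b1 := mul_le_mul_of_nonneg_left a1 hn0
      have b2 := mul_le_mul_of_nonneg_left a2 hn0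
      have b3 := mul_le_mul_of_nonneg_left (mul_le_mul_of_nonneg_left a3 hM0) hn0
      have b4 : n * ε * (n * κ ^ 2 * w) ≤ 1 / 2 * (n * κ ^ 2 * w) :=
        mul_le_mul_of_nonneg_right hn (by positivity)
      have e0 : 0 ≤ n * w := by positivity
      have e1 : 0 ≤ M * (n ^ 3 * ε ^ 2) := by positivity
      have e2 : 0 ≤ κ ^ 2 * (n * ε) := by positivity
      have e3 : 0 ≤ n ^ 3 * ε ^ 2 := by positivity
      have e4 : 0 ≤ κ ^ 2 * (n * w) := by positivity
      nlinarith

end Orthant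

/-! ### The length of a Gaussian vector -/

theorem lintegral_exp_sum_sq_le {β : ℝ} (hβ : 2 * β ≤ 1 / 2) (d : ℕ) :
    ∫⁻ x : Fin d → ℝ, ENNReal.ofReal (Real.exp (β * ∑ i, x i ^ 2))
      ∂(Measure.pi fun _ => gaussianReal 0 1) ≤
      ENNReal.ofReal (Real.exp (d * (β + 4 * β ^ 2))) := by
  have hrw : ∀ x : Fin d → ℝ, ENNReal.ofReal (Real.exp (β * ∑ i, x i ^ 2)) =
      ∏ i, ENNReal.ofReal (Real.exp (0 * x i + 2 * β / 2 * x i ^ 2)) := by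
    intro x
    rw [← ENNReal.ofReal_prod_of_nonneg fun _ _ => (Real.exp_pos _).le, ← Real.exp_sum,
      Finset.mul_sum]
    congr 2
    exact Finset.sum_congr rfl fun i _ => by ring
  simp only [hrw]
  rw [lintegral_fin_prod_eq_prod (gaussianReal 0 1)
    (f := fun _ a => ENNReal.ofReal (Real.exp (0 * a + 2 * β / 2 * a ^ 2))) (fun _ => by fun_prop)]
  simp only [lintegral_exp_gaussianReal (show 2 * β < 1 by linarith)]
  rw [Finset.prod_const, Finset.card_univ, Fintype.card_fin, ← ENNReal.ofReal_pow (by positivity),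
    Real.exp_nat_mul]
  refine ENNReal.ofReal_le_ofReal (pow_le_pow_left₀ (by positivity) ?_ d)
  refine le_trans (le_of_eq (by simp)) ((one_div_sqrt_one_sub_le_exp_add_sq hβ).trans_eq ?_)
  congr 1
  ring

/-- Concentration of `|x|² / N` around `1`, when the dimension `d` is within `√N` of `N`. Only
`A = √N` needs to be computed; smaller `A` follow by convexity. -/
theorem lintegral_exp_abs_sum_sq_sub_one_le {A N : ℝ} {d : ℕ} (hN : 16 ≤ N) (hA : 0 ≤ A)
    (hA2 : A ≤ √N) (hd : d ≤ N) (hd2 : N ≤ d + √N) :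
    ∫⁻ x : Fin d → ℝ, ENNReal.ofReal (Real.exp (A * |(∑ i, x i ^ 2) / N - 1|))
      ∂(Measure.pi fun _ => gaussianReal 0 1) ≤ ENNReal.ofReal (Real.exp (6 * (A / √N))) := by
  set R := √N with hR
  have hR2 : R ^ 2 = N := Real.sq_sqrt (by linarith)
  have hR4 : 4 ≤ R := by rw [hR, Real.le_sqrt' (by norm_num)]; linarith
  have hR0 : 0 < R := by linarith
  have hd0 : (0 : ℝ) ≤ d := Nat.cast_nonneg d
  set θ := A / R with hθ
  have hθ0 : 0 ≤ θ := by positivity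
  have hθ1 : θ ≤ 1 := (div_le_one hR0).2 hA2
  have hAθ : A = θ * R := by rw [hθ]; field_simp
  -- convexity of the exponential, and `exp |y| ≤ exp y + exp (-y)`
  have pw : ∀ x : Fin d → ℝ, ENNReal.ofReal (Real.exp (A * |(∑ i, x i ^ 2) / N - 1|)) ≤
      ENNReal.ofReal (Real.exp (6 * θ)) * (ENNReal.ofReal (1 - θ) +
        ENNReal.ofReal (θ * Real.exp (-6)) *
          (ENNReal.ofReal (Real.exp (-R)) * ENNReal.ofReal (Real.exp (1 / R * ∑ i, x i ^ 2)) +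
           ENNReal.ofReal (Real.exp R) * ENNReal.ofReal (Real.exp (-1 / R * ∑ i, x i ^ 2)))) := by
    intro x
    rw [← ENNReal.ofReal_mul (by positivity), ← ENNReal.ofReal_mul (by positivity),
      ← ENNReal.ofReal_add (by positivity) (by positivity), ← ENNReal.ofReal_mul (by positivity),
      ← ENNReal.ofReal_add (by linarith) (by positivity), ← ENNReal.ofReal_mul (by positivity)]
    refine ENNReal.ofReal_le_ofReal ?_
    set v := ∑ i, x i ^ 2
    set y := R * (v / N - 1) with hy
    have hy1 : A * |v / N - 1| = θ * |y| := by
      rw [hAθ, hy, abs_mul, abs_of_pos hR0]; ring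
    have hy2 : y = -R + 1 / R * v := by
      rw [hy, ← hR2]; field_simp; ring
    rw [hy1, ← Real.exp_add, ← Real.exp_add, show R + -1 / R * v = -y by rw [hy2]; ring, ← hy2]
    have hc := convexOn_exp.2 (Set.mem_univ (0 : ℝ)) (Set.mem_univ (|y| - 6))
      (show 0 ≤ 1 - θ by linarith) hθ0 (by ring)
    simp only [smul_eq_mul, mul_zero, zero_add, Real.exp_zero, mul_one] at hc
    have habs : Real.exp |y| ≤ Real.exp y + Real.exp (-y) := by
      rcases abs_cases y with ⟨h, _⟩ | ⟨h, _⟩ <;> rw [h] <;>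
        linarith [Real.exp_pos y, Real.exp_pos (-y)]
    calc Real.exp (θ * |y|) = Real.exp (6 * θ) * Real.exp (θ * (|y| - 6)) := by
          rw [← Real.exp_add]; ring_nf
      _ ≤ Real.exp (6 * θ) * (1 - θ + θ * Real.exp (|y| - 6)) := by gcongr
      _ = Real.exp (6 * θ) * (1 - θ + θ * Real.exp (-6) * Real.exp |y|) := by
          rw [mul_assoc, ← Real.exp_add]; ring_nf
      _ ≤ _ := by gcongr
  refine (lintegral_mono pw).trans ?_
  rw [lintegral_const_mul _ (by fun_prop), lintegral_add_left (by fun_prop),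
    lintegral_const_mul _ (by fun_prop), lintegral_add_left (by fun_prop),
    lintegral_const_mul _ (by fun_prop), lintegral_const_mul _ (by fun_prop)]
  have hRinv : 1 / R ≤ 1 / 4 := by gcongr
  have hRinv0 : 0 ≤ 1 / R := by positivity
  have b1 := lintegral_exp_sum_sq_le (β := 1 / R) (by linarith) d
  have b2 := lintegral_exp_sum_sq_le (β := -1 / R) (by rw [neg_div]; linarith) d
  have hdN : d / N ≤ 1 := (div_le_one (by linarith)).2 hd
  have hsq : (1 / R) ^ 2 = 1 / N := by rw [div_pow, hR2, one_pow]
  have hsq' : (-1 / R) ^ 2 = 1 / N := by rw [div_pow, hR2]; norm_num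
  have c1 : -R + d * (1 / R + 4 * (1 / R) ^ 2) ≤ 5 := by
    have : d * (1 / R) ≤ R := by
      rw [mul_one_div, div_le_iff₀ hR0, ← sq, hR2]; exact hd
    rw [hsq, mul_add, show d * (4 * (1 / N)) = 4 * (d / N) by ring]
    linarith
  have c2 : R + d * (-1 / R + 4 * (-1 / R) ^ 2) ≤ 5 := by
    have : R - 1 ≤ d * (1 / R) := by
      rw [mul_one_div, le_div_iff₀ hR0, sub_mul, ← sq, hR2]; linarith
    rw [hsq', mul_add, show d * (4 * (1 / N)) = 4 * (d / N) by ring, neg_div]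
    linarith
  have h2 : 2 * Real.exp 5 ≤ Real.exp 6 := by
    rw [show (6 : ℝ) = 1 + 5 by norm_num, Real.exp_add]
    exact mul_le_mul_of_nonneg_right (by linarith [Real.add_one_le_exp 1]) (Real.exp_pos _).le
  calc _ ≤ ENNReal.ofReal (Real.exp (6 * θ)) * (ENNReal.ofReal (1 - θ) +
        ENNReal.ofReal (θ * Real.exp (-6)) *
          (ENNReal.ofReal (Real.exp (-R)) *
            ENNReal.ofReal (Real.exp (d * (1 / R + 4 * (1 / R) ^ 2))) +
           ENNReal.ofReal (Real.exp R) *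
            ENNReal.ofReal (Real.exp (d * (-1 / R + 4 * (-1 / R) ^ 2))))) := by
        rw [lintegral_const, measure_univ, mul_one]
        gcongr
    _ ≤ ENNReal.ofReal (Real.exp (6 * θ)) := by
      rw [← ENNReal.ofReal_mul (by positivity), ← ENNReal.ofReal_mul (by positivity),
        ← ENNReal.ofReal_add (by positivity) (by positivity), ← ENNReal.ofReal_mul (by positivity),
        ← ENNReal.ofReal_add (by linarith) (by positivity), ← ENNReal.ofReal_mul (by positivity)]
      refine ENNReal.ofReal_le_ofReal (mul_le_of_le_one_right (Real.exp_pos _).le ?_)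
      rw [← Real.exp_add, ← Real.exp_add]
      have h3 := Real.exp_le_exp.2 c1
      have h4 := Real.exp_le_exp.2 c2
      have h5 : Real.exp (-6) * Real.exp 6 = 1 := by rw [← Real.exp_add]; norm_num
      have h6 := mul_le_mul_of_nonneg_left (((add_le_add h3 h4).trans_eq (two_mul _).symm).trans h2)
        (mul_nonneg hθ0 (Real.exp_pos (-6)).le)
      rw [mul_assoc θ _ (Real.exp 6), h5] at h6
      linarith

/-! ### Exposing one Gaussian vector -/

/-- The law of a vector of `d` independent standard Gaussian coordinates. -/
noncomputable abbrev gaussianCoordinates (d : ℕ) : Measure (Fin d → ℝ) :=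
  Measure.pi fun _ => gaussianReal 0 1

/-- The probability that `n` independent standard Gaussian vectors in `ℝ^d` satisfy
`t i j ≤ s ⟨x_i, x_j⟩` for all `i < j`. The thresholds are arbitrary, because exposing a vector
shifts the thresholds of the remaining pairs. -/
noncomputable def gramProb (n d : ℕ) (s : ℝ) (t : Fin n → Fin n → ℝ) : ENNReal :=
  (Measure.pi fun _ : Fin n => gaussianCoordinates d)
    {x | ∀ i j, i < j → t i j ≤ s * (x i ⬝ᵥ x j)}

theorem measurableSet_gram {n d : ℕ} (s : ℝ) (t : Fin n → Fin n → ℝ) :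
    MeasurableSet {x : Fin n → Fin d → ℝ | ∀ i j, i < j → t i j ≤ s * (x i ⬝ᵥ x j)} := by
  simp only [Set.ofPred_forall, dotProduct]
  refine MeasurableSet.iInter fun i => MeasurableSet.iInter fun j => MeasurableSet.iInter fun _ =>
    measurableSet_le measurable_const ?_
  fun_prop

/-- Rotation invariance: some orthogonal map preserving the Gaussian law turns `x₀` into
`± |x₀| e₀`, with the sign of `s`. -/
theorem exists_measurePreserving_rotation {d : ℕ} (s : ℝ) (x₀ : Fin (d + 1) → ℝ) :
    ∃ U : (Fin (d + 1) → ℝ) → (Fin (d + 1) → ℝ),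
      MeasurePreserving U (gaussianCoordinates (d + 1)) (gaussianCoordinates (d + 1)) ∧
      (∀ x y, U x ⬝ᵥ U y = x ⬝ᵥ y) ∧
      ∀ x, s * (x₀ ⬝ᵥ U x) = |s| * √(∑ i, x₀ i ^ 2) * x 0 := by
  obtain ⟨η, hη, hs⟩ : ∃ η : ℝ, |η| = 1 ∧ s * η = |s| := by
    rcases le_total 0 s with h | h
    · exact ⟨1, by simp, by rw [abs_of_nonneg h, mul_one]⟩
    · exact ⟨-1, by simp, by rw [abs_of_nonpos h]; ring⟩
  set w : EuclideanSpace ℝ (Fin (d + 1)) := WithLp.toLp 2 x₀ with hw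
  set v : EuclideanSpace ℝ (Fin (d + 1)) := EuclideanSpace.single 0 (η * ‖w‖) with hv
  have hvw : ‖v‖ = ‖w‖ := by
    simp [hv, hη]
  set R := (Submodule.span ℝ {v - w})ᗮ.reflection with hR
  have hRv : R v = w := Submodule.reflection_sub hvw
  have hto : MeasurePreserving (WithLp.toLp 2) (gaussianCoordinates (d + 1))
      (stdGaussian (EuclideanSpace ℝ (Fin (d + 1)))) := ⟨by fun_prop, map_pi_eq_stdGaussian⟩
  have hRm : MeasurePreserving R (stdGaussian (EuclideanSpace ℝ (Fin (d + 1))))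
      (stdGaussian (EuclideanSpace ℝ (Fin (d + 1)))) :=
    ⟨R.continuous.measurable, stdGaussian_map R⟩
  have hof : MeasurePreserving (WithLp.ofLp)
      (stdGaussian (EuclideanSpace ℝ (Fin (d + 1)))) (gaussianCoordinates (d + 1)) := by
    refine ⟨by fun_prop, ?_⟩
    rw [← map_pi_eq_stdGaussian, Measure.map_map (by fun_prop) (by fun_prop)]
    exact Measure.map_id
  have hdot : ∀ x y : EuclideanSpace ℝ (Fin (d + 1)), x.ofLp ⬝ᵥ y.ofLp = inner ℝ x y := by
    intro x y
    rw [EuclideanSpace.inner_eq_star_dotProduct, dotProduct_comm]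
    simp
  refine ⟨fun x => (R (WithLp.toLp 2 x)).ofLp, hof.comp (hRm.comp hto), fun x y => ?_, fun x => ?_⟩
  · rw [hdot, R.inner_map_map, ← hdot]
  · have h1 : x₀ ⬝ᵥ (R (WithLp.toLp 2 x)).ofLp = η * ‖w‖ * x 0 := by
      rw [show x₀ = w.ofLp from rfl, hdot, ← hRv, R.inner_map_map, hv,
        EuclideanSpace.inner_single_left]
      simp [hη]
    have h2 : √(∑ i, x₀ i ^ 2) = ‖w‖ := by
      rw [EuclideanSpace.norm_eq]
      simp [hw]
    rw [h1, h2, ← hs]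
    ring

/-- Splitting off the first coordinate of each of `n` Gaussian vectors. -/
theorem measurePreserving_split_coordinate (n d : ℕ) :
    MeasurePreserving
      (fun x : Fin n → Fin (d + 1) → ℝ =>
        ((fun j => x j 0 : Fin n → ℝ), (fun j k => x j k.succ : Fin n → Fin d → ℝ)))
      (Measure.pi fun _ => gaussianCoordinates (d + 1))
      ((gaussianCoordinates n).prod (Measure.pi fun _ => gaussianCoordinates d)) := by
  have h1 := measurePreserving_pi (fun _ : Fin n => gaussianCoordinates (d + 1))
    (fun _ : Fin n => (gaussianReal 0 1).prod (gaussianCoordinates d))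
    (fun _ => measurePreserving_piFinSuccAbove (fun _ : Fin (d + 1) => gaussianReal 0 1) 0)
  have h2 := measurePreserving_arrowProdEquivProdArrow ℝ (Fin d → ℝ) (Fin n)
    (fun _ => gaussianReal 0 1) (fun _ => gaussianCoordinates d)
  exact h2.comp h1

theorem dotProduct_fin_succ {d : ℕ} (x y : Fin (d + 1) → ℝ) :
    x ⬝ᵥ y = x 0 * y 0 + (fun k : Fin d => x k.succ) ⬝ᵥ fun k => y k.succ := by
  simp [dotProduct, Fin.sum_univ_succ]

/-- Exposing the first vector `x₀`. Along `x₀` the others have independent Gaussian coordinates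
`z_j`, which decide the pairs containing `x₀`; orthogonally to it they are Gaussian vectors in one
dimension less, and each remaining product `⟨x_j, x_k⟩` is reduced by `z_j z_k`. -/
theorem gramProb_succ_succ (n d : ℕ) (s : ℝ) (t : Fin (n + 1) → Fin (n + 1) → ℝ) :
    gramProb (n + 1) (d + 1) s t =
      ∫⁻ x₀, ∫⁻ z, {z : Fin n → ℝ | ∀ j, t 0 j.succ ≤ |s| * √(∑ i, x₀ i ^ 2) * z j}.indicator 1 z *
        gramProb n d s (fun j k => t j.succ k.succ - s * (z j * z k))
        ∂(gaussianCoordinates n) ∂(gaussianCoordinates (d + 1)) := by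
  have hms := measurableSet_gram (d := d + 1) s t
  have h0 := measurePreserving_piFinSuccAbove (fun _ : Fin (n + 1) => gaussianCoordinates (d + 1)) 0
  rw [gramProb, ← h0.symm.measure_preimage hms.nullMeasurableSet,
    Measure.prod_apply (h0.symm.measurable hms)]
  refine lintegral_congr fun x₀ => ?_
  obtain ⟨U, hU, hUdot, hU0⟩ := exists_measurePreserving_rotation s x₀
  have hUn := measurePreserving_pi (fun _ : Fin n => gaussianCoordinates (d + 1))
    (fun _ : Fin n => gaussianCoordinates (d + 1)) fun _ => hU
  set S : Set (Fin n → Fin (d + 1) → ℝ) := Prod.mk x₀ ⁻¹'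
    ((MeasurableEquiv.piFinSuccAbove (fun _ : Fin (n + 1) => Fin (d + 1) → ℝ) 0).symm ⁻¹'
      {x | ∀ i j, i < j → t i j ≤ s * (x i ⬝ᵥ x j)}) with hS
  have hSm : MeasurableSet S := measurable_prodMk_left (h0.symm.measurable hms)
  have hSmem : ∀ x, x ∈ S ↔ (∀ j, t 0 j.succ ≤ s * (x₀ ⬝ᵥ x j)) ∧
      ∀ j k, j < k → t j.succ k.succ ≤ s * (x j ⬝ᵥ x k) := by
    intro x
    simp only [hS, Set.mem_preimage, Set.mem_ofPred_eq, MeasurableEquiv.piFinSuccAbove_symm_apply,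
      Fin.insertNthEquiv_zero, Fin.consEquiv_apply]
    constructor
    · intro h
      exact ⟨fun j => h 0 j.succ (Fin.succ_pos j),
        fun j k hjk => h j.succ k.succ (Fin.succ_lt_succ_iff.2 hjk)⟩
    · rintro ⟨h1, h2⟩ i j hij
      obtain ⟨j, rfl⟩ := Fin.exists_succ_eq_of_ne_zero (Fin.ne_zero_of_lt hij)
      refine Fin.cases (fun _ => h1 j) (fun i hij => h2 i j (Fin.succ_lt_succ_iff.1 hij)) i hij
  set T : Set ((Fin n → ℝ) × (Fin n → Fin d → ℝ)) :=
    {p | (∀ j, t 0 j.succ ≤ |s| * √(∑ i, x₀ i ^ 2) * p.1 j) ∧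
      ∀ j k, j < k → t j.succ k.succ ≤ s * (p.1 j * p.1 k + p.2 j ⬝ᵥ p.2 k)} with hT
  have hTm : MeasurableSet T := by
    simp only [hT, Set.ofPred_and, Set.ofPred_forall, dotProduct]
    refine (MeasurableSet.iInter fun j => measurableSet_le measurable_const (by fun_prop)).inter
      (MeasurableSet.iInter fun j => MeasurableSet.iInter fun k => MeasurableSet.iInter
        fun _ => measurableSet_le measurable_const ?_)
    fun_prop
  have hpre : (fun a i => U (a i)) ⁻¹' S = (fun x : Fin n → Fin (d + 1) → ℝ =>
      ((fun j => x j 0 : Fin n → ℝ), (fun j k => x j k.succ : Fin n → Fin d → ℝ))) ⁻¹' T := by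
    ext x
    rw [Set.mem_preimage, hSmem]
    simp only [hU0, hUdot]
    simp only [hT, Set.mem_preimage, Set.mem_ofPred_eq, dotProduct_fin_succ]
  calc (Measure.pi fun _ : Fin n => gaussianCoordinates (d + 1)) S
      = _ := (hUn.measure_preimage hSm.nullMeasurableSet).symm
    _ = ((gaussianCoordinates n).prod (Measure.pi fun _ => gaussianCoordinates d)) T := by
      rw [hpre, (measurePreserving_split_coordinate n d).measure_preimage hTm.nullMeasurableSet]
    _ = _ := by
      rw [Measure.prod_apply hTm]
      refine lintegral_congr fun z => ?_
      by_cases hz : ∀ j, t 0 j.succ ≤ |s| * √(∑ i, x₀ i ^ 2) * z j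
      · rw [Set.indicator_of_mem (by exact hz), Pi.one_apply, one_mul, gramProb]
        congr 1
        ext x
        simp only [hT, Set.mem_preimage, Set.mem_ofPred_eq, hz, implies_true, true_and, mul_add,
          sub_le_iff_le_add']
      · rw [Set.indicator_of_notMem (by exact hz), zero_mul]
        refine measure_mono_null (fun x hx => ?_) measure_empty
        exact hz hx.1

/-! ### The bound on orthant probabilities of Gram matrices -/

theorem lintegral_indicator_mul_exp_pairs_le {τ M : ℝ} (hM0 : 0 ≤ M)
    (hM : ∀ χ t : ℝ, 0 ≤ χ → (gaussianReal 0 1).real {z | t ≤ χ * z} ≤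
      gaussianTail τ * Real.exp (gaussianHazard τ * (τ - t) + M * |χ ^ 2 - 1|))
    {χ ε σ : ℝ} (hσ : σ = 1 ∨ σ = -1) (hχ : 0 ≤ χ) (hε : 0 ≤ ε) (hε2 : ε ≤ 1 / 2) {n : ℕ}
    (hn : n * ε ≤ 1 / 2) (t : Fin n → ℝ) :
    ∫⁻ z, {z : Fin n → ℝ | ∀ j, t j ≤ χ * z j}.indicator 1 z *
        ENNReal.ofReal (Real.exp (σ * ε * ∑ i, ∑ j ∈ Finset.Ioi i, z i * z j))
          ∂(Measure.pi fun _ => gaussianReal 0 1) ≤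
      ENNReal.ofReal (gaussianTail τ ^ n *
        Real.exp (gaussianHazard τ * ∑ j, (τ - t j) +
          σ * ε * gaussianHazard τ ^ 2 * (n ^ 2 / 2) +
          (2 * M + gaussianHazard τ ^ 2 + 1) * (n * |χ ^ 2 - 1| + n * ε + n ^ 3 * ε ^ 2))) := by
  rcases hσ with rfl | rfl
  · simp only [one_mul]
    refine (lintegral_indicator_mul_exp_pairs_le_of_pos hM0 hM hχ hε hn t).trans
      (ENNReal.ofReal_le_ofReal ?_)
    have := (gaussianTail_pos τ).le
    gcongr
    linarith
  · simp only [neg_one_mul]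
    exact lintegral_indicator_mul_exp_pairs_le_of_neg hM0 hM hχ hε hε2 hn t

/-- The factor gained by exposing one vector `x₀` of length close to `√N`. -/
theorem lintegral_lintegral_indicator_mul_exp_pairs_le {τ M : ℝ} (hM0 : 0 ≤ M)
    (hM : ∀ χ t : ℝ, 0 ≤ χ → (gaussianReal 0 1).real {z | t ≤ χ * z} ≤
      gaussianTail τ * Real.exp (gaussianHazard τ * (τ - t) + M * |χ ^ 2 - 1|))
    {ε σ N : ℝ} (hσ : σ = 1 ∨ σ = -1) (hN : 16 ≤ N) (hε : 0 ≤ ε) (hε2 : ε ≤ 1 / 2) {n d : ℕ}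
    (hn : n * ε ≤ 1 / 2) (hd : d ≤ N) (hd2 : N ≤ d + √N)
    (hB : (2 * M + gaussianHazard τ ^ 2 + 1) * n ≤ √N) (t : Fin n → ℝ) :
    ∫⁻ x₀, ∫⁻ z,
        {z : Fin n → ℝ | ∀ j, t j ≤ |σ / √N| * √(∑ i, x₀ i ^ 2) * z j}.indicator 1 z *
        ENNReal.ofReal (Real.exp (σ * ε * ∑ i, ∑ j ∈ Finset.Ioi i, z i * z j))
          ∂(gaussianCoordinates n) ∂(gaussianCoordinates d) ≤
      ENNReal.ofReal (gaussianTail τ ^ n *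
        Real.exp (gaussianHazard τ * ∑ j, (τ - t j) +
          σ * ε * gaussianHazard τ ^ 2 * (n ^ 2 / 2) +
          (2 * M + gaussianHazard τ ^ 2 + 1) * (n * ε + n ^ 3 * ε ^ 2 + 6 * (n / √N)))) := by
  have hq := gaussianTail_pos τ
  set κ := gaussianHazard τ
  set B := 2 * M + κ ^ 2 + 1 with hBdef
  have hB0 : 0 < B := by positivity
  have hN0 : 0 < N := by linarith
  have hσ2 : σ ^ 2 = 1 := by rcases hσ with rfl | rfl <;> norm_num
  have hpt : ∀ x₀ : Fin d → ℝ, ∫⁻ z,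
        {z : Fin n → ℝ | ∀ j, t j ≤ |σ / √N| * √(∑ i, x₀ i ^ 2) * z j}.indicator 1 z *
        ENNReal.ofReal (Real.exp (σ * ε * ∑ i, ∑ j ∈ Finset.Ioi i, z i * z j))
          ∂(gaussianCoordinates n) ≤
      ENNReal.ofReal (gaussianTail τ ^ n *
        Real.exp (κ * ∑ j, (τ - t j) + σ * ε * κ ^ 2 * (n ^ 2 / 2) +
          B * (n * ε + n ^ 3 * ε ^ 2))) *
        ENNReal.ofReal (Real.exp (B * n * |(∑ i, x₀ i ^ 2) / N - 1|)) := by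
    intro x₀
    refine (lintegral_indicator_mul_exp_pairs_le hM0 hM hσ (by positivity) hε hε2 hn t).trans ?_
    have hsum : 0 ≤ ∑ i, x₀ i ^ 2 := Finset.sum_nonneg fun _ _ => sq_nonneg _
    rw [← ENNReal.ofReal_mul (by positivity), mul_pow, sq_abs, div_pow, hσ2, Real.sq_sqrt hN0.le,
      Real.sq_sqrt hsum, mul_assoc (gaussianTail τ ^ n), ← Real.exp_add, one_div_mul_eq_div]
    refine le_of_eq ?_
    congr 3
    ring
  refine (lintegral_mono hpt).trans ?_
  rw [lintegral_const_mul _ (by fun_prop)]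
  refine (mul_le_mul_right (lintegral_exp_abs_sum_sq_sub_one_le hN (by positivity) hB hd hd2)
    _).trans (le_of_eq ?_)
  rw [← ENNReal.ofReal_mul (by positivity), mul_assoc (gaussianTail τ ^ n), ← Real.exp_add]
  congr 3
  ring

theorem gramProb_le_one (n d : ℕ) (s : ℝ) (t : Fin n → Fin n → ℝ) : gramProb n d s t ≤ 1 :=
  prob_le_one

theorem sq_div_add_pow_four_div_succ (n : ℕ) {a b : ℝ} (ha : 0 ≤ a) (hb : 0 ≤ b) :
    (n : ℝ) ^ 2 / a + n ^ 4 / b + (n / a + n ^ 3 / b) ≤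
      ((n + 1 : ℕ) : ℝ) ^ 2 / a + ((n + 1 : ℕ) : ℝ) ^ 4 / b := by
  have h : ((n + 1 : ℕ) : ℝ) ^ 2 / a + ((n + 1 : ℕ) : ℝ) ^ 4 / b =
      (n : ℝ) ^ 2 / a + n ^ 4 / b + (n / a + n ^ 3 / b) +
        ((n + 1) / a + (3 * n ^ 3 + 6 * n ^ 2 + 4 * n + 1) / b) := by
    push_cast
    ring
  rw [h]
  exact le_add_of_nonneg_right (by positivity)

/-- The induction on the number of vectors. The thresholds enter through an exponential of slope
`κ`, the hazard rate at `τ`, in each entry; this form is preserved when the thresholds are shifted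
by `s z_j z_k`, and the resulting weight `exp (κ s ∑ z_j z_k)` produces the triangle term. -/
theorem gramProb_le {τ M : ℝ} (hM0 : 0 ≤ M)
    (hM : ∀ χ t : ℝ, 0 ≤ χ → (gaussianReal 0 1).real {z | t ≤ χ * z} ≤
      gaussianTail τ * Real.exp (gaussianHazard τ * (τ - t) + M * |χ ^ 2 - 1|))
    {σ : ℝ} (hσ : σ = 1 ∨ σ = -1) {N r : ℕ} (hN : 16 ≤ N)
    (hB : (2 * M + gaussianHazard τ ^ 2 + 1) * r ≤ √N)
    (hr : 2 * gaussianHazard τ * r ≤ √N) (hκ2 : 2 * gaussianHazard τ ≤ √N)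
    (n : ℕ) : ∀ (d : ℕ) (t : Fin n → Fin n → ℝ), n ≤ r → d ≤ N → N + n ≤ d + r →
    gramProb n d (σ / √N) t ≤ ENNReal.ofReal (gaussianTail τ ^ n.choose 2 *
      Real.exp (gaussianHazard τ * ∑ i, ∑ j ∈ Finset.Ioi i, (τ - t i j) +
        (σ * gaussianHazard τ ^ 3 / √N * n.choose 3 +
          (gaussianHazard τ ^ 3 + (2 * M + gaussianHazard τ ^ 2 + 1) *
            (gaussianHazard τ + gaussianHazard τ ^ 2 + 6)) * (n ^ 2 / √N + n ^ 4 / N)))) := by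
  have hq := gaussianTail_pos τ
  set κ := gaussianHazard τ with hκ
  have hκ0 : 0 < κ := gaussianHazard_pos τ
  set B := 2 * M + κ ^ 2 + 1 with hBdef
  have hB1 : 1 ≤ B := by have := sq_nonneg κ; linarith
  set R := √(N : ℝ) with hR
  have hN' : (16 : ℝ) ≤ N := by exact_mod_cast hN
  have hR2 : R ^ 2 = N := Real.sq_sqrt (by linarith)
  have hR4 : 4 ≤ R := by rw [hR, Real.le_sqrt' (by norm_num)]; linarith
  have hR0 : 0 < R := by linarith
  have hrR : r ≤ R := le_trans (le_mul_of_one_le_left (Nat.cast_nonneg r) hB1) hB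
  have hrN : r < N := by
    have : (r : ℝ) < N := by nlinarith
    exact_mod_cast this
  induction n with
  | zero => intro d t _ _ _; simpa using gramProb_le_one 0 d (σ / R) t
  | succ n ih =>
    intro d t hnr hdN hNd
    obtain ⟨d, rfl⟩ : ∃ e, d = e + 1 := ⟨d - 1, by omega⟩
    have hn' : (n : ℝ) ≤ r := by exact_mod_cast (Nat.le_succ n).trans hnr
    have hn0 : (0 : ℝ) ≤ n := Nat.cast_nonneg n
    set E := σ * κ ^ 3 / R * n.choose 3 +
      (κ ^ 3 + B * (κ + κ ^ 2 + 6)) * (n ^ 2 / R + n ^ 4 / N) with hE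
    set P := ∑ i : Fin n, ∑ j ∈ Finset.Ioi i, (τ - t i.succ j.succ) with hP
    have hinner : ∀ z : Fin n → ℝ,
        gramProb n d (σ / R) (fun j k => t j.succ k.succ - σ / R * (z j * z k)) ≤
        ENNReal.ofReal (gaussianTail τ ^ n.choose 2 * Real.exp (κ * P + E)) *
          ENNReal.ofReal
            (Real.exp (σ * (κ / R) * ∑ i, ∑ j ∈ Finset.Ioi i, z i * z j)) := by
      intro z
      refine (ih d _ (by omega) (by omega) (by omega)).trans (le_of_eq ?_)
      rw [← ENNReal.ofReal_mul (by positivity), mul_assoc, ← Real.exp_add]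
      congr 3
      rw [hP, Finset.mul_sum, Finset.mul_sum, Finset.mul_sum]
      simp only [Finset.mul_sum]
      rw [add_right_comm, ← Finset.sum_add_distrib]
      simp only [← Finset.sum_add_distrib]
      congr 1
      refine Finset.sum_congr rfl fun i _ => Finset.sum_congr rfl fun j _ => ?_
      ring
    rw [gramProb_succ_succ]
    have hfirst : ∀ (x₀ : Fin (d + 1) → ℝ) (z : Fin n → ℝ),
        {z : Fin n → ℝ | ∀ j, t 0 j.succ ≤ |σ / R| * √(∑ i, x₀ i ^ 2) * z j}.indicator 1 z *
          gramProb n d (σ / R) (fun j k => t j.succ k.succ - σ / R * (z j * z k)) ≤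
        ENNReal.ofReal (gaussianTail τ ^ n.choose 2 * Real.exp (κ * P + E)) *
          ({z : Fin n → ℝ | ∀ j, t 0 j.succ ≤ |σ / R| * √(∑ i, x₀ i ^ 2) * z j}.indicator 1 z *
          ENNReal.ofReal
            (Real.exp (σ * (κ / R) * ∑ i, ∑ j ∈ Finset.Ioi i, z i * z j))) := by
      intro x₀ z
      rw [mul_left_comm]
      exact mul_le_mul_right (hinner z) _
    refine (lintegral_mono fun x₀ => lintegral_mono (hfirst x₀)).trans ?_
    simp only [lintegral_const_mul' _ _ ENNReal.ofReal_ne_top]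
    have hnR : (n : ℝ) / R ≤ 1 := (div_le_one hR0).2 (hn'.trans hrR)
    have h1 : (n : ℝ) * (κ / R) ≤ 1 / 2 := by
      rw [mul_div_assoc', div_le_iff₀ hR0]
      nlinarith [mul_le_mul_of_nonneg_left hn' hκ0.le]
    have h2 : κ / R ≤ 1 / 2 := by
      rw [div_le_iff₀ hR0]; linarith
    have h3 : ((d + 1 : ℕ) : ℝ) ≤ N := by exact_mod_cast hdN
    have h4 : (N : ℝ) ≤ ((d + 1 : ℕ) : ℝ) + √(N : ℝ) := by
      have : (N : ℝ) ≤ ((d + 1 : ℕ) : ℝ) + r := by exact_mod_cast (by omega : N ≤ d + 1 + r)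
      linarith
    have h5 : (2 * M + gaussianHazard τ ^ 2 + 1) * n ≤ √(N : ℝ) :=
      (mul_le_mul_of_nonneg_left hn' (by linarith)).trans hB
    refine (mul_le_mul_right (lintegral_lintegral_indicator_mul_exp_pairs_le hM0 hM hσ hN'
      (by positivity) h2 h1 h3 h4 h5 fun j => t 0 j.succ) _).trans ?_
    rw [← hκ, ← hR, ← hBdef, ← ENNReal.ofReal_mul (by positivity)]
    refine ENNReal.ofReal_le_ofReal ?_
    have hc2 : (n + 1).choose 2 = n.choose 2 + n := by
      rw [Nat.choose_succ_succ, Nat.choose_one_right, add_comm]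
    have hc3 : (n + 1).choose 3 = n.choose 3 + n.choose 2 := by
      rw [Nat.choose_succ_succ, add_comm]
    rw [mul_mul_mul_comm, ← pow_add, ← hc2, ← Real.exp_add]
    refine mul_le_mul_of_nonneg_left (Real.exp_le_exp.2 ?_) (by positivity)
    rw [hc3, Fin.sum_univ_succ]
    simp only [Fin.sum_Ioi_zero, Fin.sum_Ioi_succ]
    rw [← hP]
    have hsq : (κ / R) ^ 2 = κ ^ 2 / N := by rw [div_pow, hR2]
    have hch : (n : ℝ) ^ 2 / 2 = n.choose 2 + n / 2 := by
      rw [Nat.cast_choose_two]; ring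
    have hσ1 : σ ≤ 1 := by rcases hσ with rfl | rfl <;> norm_num
    have main : σ * (κ / R) * κ ^ 2 * (n ^ 2 / 2) +
        B * (n * (κ / R) + n ^ 3 * (κ / R) ^ 2 + 6 * (n / R)) ≤
        σ * κ ^ 3 / R * n.choose 2 +
          (κ ^ 3 + B * (κ + κ ^ 2 + 6)) * (n / R + n ^ 3 / N) := by
      rw [hsq, hch]
      have e1 : σ * (κ ^ 3 * (n / R)) ≤ 1 * (κ ^ 3 * (n / R)) :=
        mul_le_mul_of_nonneg_right hσ1 (by positivity)
      have e2 : 0 ≤ κ ^ 3 * (n / R) := by positivity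
      have e3 : 0 ≤ κ ^ 3 * (n ^ 3 / N : ℝ) := by positivity
      have e4 : 0 ≤ B * κ * (n ^ 3 / N : ℝ) := by positivity
      have e5 : 0 ≤ B * (n ^ 3 / N : ℝ) := by positivity
      have e6 : 0 ≤ B * κ ^ 2 * (n / R) := by positivity
      calc _ = σ * κ ^ 3 / R * n.choose 2 + σ * (κ ^ 3 * (n / R)) / 2 +
            (B * κ * (n / R) + B * κ ^ 2 * (n ^ 3 / N) + 6 * (B * (n / R))) := by ring
        _ ≤ σ * κ ^ 3 / R * n.choose 2 + κ ^ 3 * (n / R) +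
            (B * κ * (n / R) + B * κ ^ 2 * (n ^ 3 / N) + 6 * (B * (n / R))) := by linarith
        _ ≤ _ := by linarith
    have hgrow := sq_div_add_pow_four_div_succ n hR0.le (Nat.cast_nonneg (α := ℝ) N)
    have hgrow' := mul_le_mul_of_nonneg_left hgrow
      (show 0 ≤ κ ^ 3 + B * (κ + κ ^ 2 + 6) by positivity)
    rw [hE]
    push_cast at hgrow' ⊢
    linarith

/-- The orthant probability of the Gram matrix of `r` Gaussian vectors in `ℝ^N`, with sign `σ`:
relative to independent entries, its logarithm gains `σ κ³ / √N` for each triangle, where `κ` is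
the hazard rate, up to an error of order `r² / √N + r⁴ / N`. -/
theorem exists_gramProb_const_le (τ : ℝ) : ∃ B : ℝ, 0 < B ∧ ∀ σ : ℝ, (σ = 1 ∨ σ = -1) →
    ∀ r N : ℕ, 1 ≤ N → gramProb r N (σ / √N) (fun _ _ => τ) ≤
      ENNReal.ofReal (gaussianTail τ ^ r.choose 2 *
        Real.exp (σ * gaussianHazard τ ^ 3 / √N * r.choose 3 + B * (r ^ 2 / √N + r ^ 4 / N))) := by
  obtain ⟨M, hM0, hM⟩ := exists_gaussianReal_real_le_mul_le τ
  have hq := gaussianTail_pos τ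
  set κ := gaussianHazard τ with hκ
  have hκ0 : 0 < κ := gaussianHazard_pos τ
  set B := 2 * M + κ ^ 2 + 1 with hBdef
  have hB0 : 0 < B := by positivity
  set B₀ := B + 2 * κ + 4 with hB₀
  set L := -Real.log (gaussianTail τ) with hL
  have hL0 : 0 ≤ L := by
    have := Real.log_nonpos hq.le (gaussianTail_le_one τ)
    linarith
  set B₁ := κ ^ 3 + B * (κ + κ ^ 2 + 6) with hB₁
  set B₂ := L * B₀ ^ 2 + κ ^ 3 * B₀ with hB₂
  have hB₁0 : 0 < B₁ := by positivity
  have hB₂0 : 0 ≤ B₂ := by positivity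
  refine ⟨B₁ + B₂, by positivity, fun σ hσ r N hN => ?_⟩
  have hN0 : (0 : ℝ) < N := by exact_mod_cast hN
  set R := √(N : ℝ) with hR
  have hR0 : 0 < R := Real.sqrt_pos.2 hN0
  have hR2 : R ^ 2 = N := Real.sq_sqrt hN0.le
  rcases Nat.eq_zero_or_pos r with rfl | hr
  · simpa using gramProb_le_one 0 N (σ / R) fun _ _ => τ
  have hr1 : (1 : ℝ) ≤ r := by exact_mod_cast hr
  rcases le_or_gt (B₀ * r) R with h | h
  · have h16 : 16 ≤ N := by
      have h4 : 4 ≤ R := by nlinarith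
      have : (16 : ℝ) ≤ N := by nlinarith
      exact_mod_cast this
    have hBr : 0 ≤ B * r := by positivity
    have hκr : κ ≤ κ * r := le_mul_of_one_le_right hκ0.le hr1
    have hexp : B₀ * r = B * r + 2 * (κ * r) + 4 * r := by rw [hB₀]; ring
    refine (gramProb_le hM0.le hM hσ h16 (by linarith) (by linarith) (by linarith) r N
      (fun _ _ => τ) le_rfl le_rfl le_rfl).trans (ENNReal.ofReal_le_ofReal ?_)
    simp only [sub_self, Finset.sum_const_zero, mul_zero, zero_add]
    refine mul_le_mul_of_nonneg_left (Real.exp_le_exp.2 ?_) (by positivity)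
    rw [← hκ, ← hR, ← hBdef, ← hB₁]
    gcongr
    linarith
  -- for `√N < B₀ r` the error term already outweighs everything else
  · refine (gramProb_le_one _ _ _ _).trans ?_
    rw [ENNReal.one_le_ofReal, ← Real.exp_log (pow_pos hq (r.choose 2)), ← Real.exp_add,
      Real.one_le_exp_iff, Real.log_pow]
    have hc2 : (r.choose 2 : ℝ) ≤ r ^ 2 := by exact_mod_cast Nat.choose_le_pow r 2
    have hc3 : (r.choose 3 : ℝ) ≤ r ^ 3 := by exact_mod_cast Nat.choose_le_pow r 3
    set ρ := r / R with hρ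
    have hρ0 : 0 < ρ := by positivity
    have hρ1 : 1 ≤ B₀ * ρ := by
      rw [hρ, mul_div_assoc', one_le_div hR0]; exact h.le
    have e1 : (r : ℝ) ^ 4 / N = r ^ 2 * ρ ^ 2 := by rw [hρ, div_pow, hR2]; ring
    have e2 : L * r.choose 2 ≤ L * (r ^ 2 * (B₀ * ρ) ^ 2) := by
      refine mul_le_mul_of_nonneg_left (hc2.trans ?_) hL0
      exact le_mul_of_one_le_right (by positivity) (one_le_pow₀ hρ1)
    have e3 : -(κ ^ 3 * (r ^ 2 * (B₀ * ρ) * ρ)) ≤ σ * κ ^ 3 / R * r.choose 3 := by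
      have hσ1 : -1 ≤ σ := by rcases hσ with rfl | rfl <;> norm_num
      have a1 : -1 * (κ ^ 3 / R * r.choose 3) ≤ σ * (κ ^ 3 / R * r.choose 3) :=
        mul_le_mul_of_nonneg_right hσ1 (by positivity)
      have a2 : κ ^ 3 / R * r.choose 3 ≤ κ ^ 3 / R * r ^ 3 := by gcongr
      have a3 : κ ^ 3 / R * r ^ 3 = κ ^ 3 * (r ^ 2 * ρ) := by rw [hρ]; ring
      have a4 : κ ^ 3 * (r ^ 2 * ρ) ≤ κ ^ 3 * (r ^ 2 * ρ) * (B₀ * ρ) :=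
        le_mul_of_one_le_right (by positivity) hρ1
      calc -(κ ^ 3 * (r ^ 2 * (B₀ * ρ) * ρ)) = -(κ ^ 3 * (r ^ 2 * ρ) * (B₀ * ρ)) := by ring
        _ ≤ σ * (κ ^ 3 / R * r.choose 3) := by linarith
        _ = _ := by ring
    have e4 : 0 ≤ (B₁ + B₂) * (r ^ 2 / R) := by positivity
    have e5 : 0 ≤ B₁ * (r ^ 2 * ρ ^ 2) := by positivity
    have e6 : B₂ * (r ^ 2 * ρ ^ 2) = L * (r ^ 2 * (B₀ * ρ) ^ 2) +
        κ ^ 3 * (r ^ 2 * (B₀ * ρ) * ρ) := by rw [hB₂]; ring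
    rw [e1, mul_add, add_mul B₁ B₂ (_ * _), e6, show Real.log (gaussianTail τ) = -L by
      rw [hL, neg_neg]]
    linarith

/-! ### From the random graph to Gram matrices -/

theorem measurePreserving_gaussianVector (d : ℕ) :
    MeasurePreserving (fun x : Fin d → ℝ => (√(d : ℝ))⁻¹ • WithLp.toLp 2 x)
      (gaussianCoordinates d) (gaussianVector d) := by
  refine ⟨by fun_prop, ?_⟩
  have hcomp := Measure.map_map (μ := gaussianCoordinates d) (f := WithLp.toLp 2)
    (g := fun x : EuclideanSpace ℝ (Fin d) => (√(d : ℝ))⁻¹ • x) (by fun_prop) (by fun_prop)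
  rw [Function.comp_def, map_pi_eq_stdGaussian] at hcomp
  rw [← hcomp]
  have hpsd : ((1 / (d : ℝ)) • (1 : Matrix (Fin d) (Fin d) ℝ)).PosSemidef :=
    Matrix.PosSemidef.one.smul (by positivity)
  have : IsProbabilityMeasure (gaussianVector d) := by unfold gaussianVector; infer_instance
  have : IsProbabilityMeasure (Measure.map (fun x : EuclideanSpace ℝ (Fin d) => (√(d : ℝ))⁻¹ • x)
      (stdGaussian (EuclideanSpace ℝ (Fin d)))) :=
    Measure.isProbabilityMeasure_map (by fun_prop)
  refine Measure.ext_of_charFun ?_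
  ext x
  rw [charFun_map_smul, charFun_stdGaussian, gaussianVector, charFun_multivariateGaussian hpsd]
  congr 1
  have h1 : x.ofLp ⬝ᵥ ((1 / (d : ℝ)) • (1 : Matrix (Fin d) (Fin d) ℝ)).mulVec x.ofLp =
      1 / d * ‖x‖ ^ 2 := by
    rw [Matrix.smul_mulVec, Matrix.one_mulVec, dotProduct_smul, EuclideanSpace.real_norm_sq_eq]
    simp [dotProduct, sq]
  rw [h1, norm_smul, Complex.ofReal_mul, mul_pow, ← Complex.ofReal_pow ‖(√(d : ℝ))⁻¹‖,
    Real.norm_eq_abs, sq_abs, inv_pow, Real.sq_sqrt (Nat.cast_nonneg d)]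
  simp
  ring

theorem gaussianSample_real_le_gramProb {n d : ℕ} (hd : 1 ≤ d) (s τ : ℝ)
    {S : Set (Fin n → EuclideanSpace ℝ (Fin d))}
    (hS : ∀ x ∈ S, ∀ i j, i < j → τ ≤ s * (√(d : ℝ) * inner ℝ (x i) (x j))) :
    (gaussianSample n d).real S ≤ (gramProb n d (s / √d) fun _ _ => τ).toReal := by
  have hd0 : (0 : ℝ) < d := by exact_mod_cast hd
  have hR : 0 < √(d : ℝ) := Real.sqrt_pos.2 hd0
  have : IsProbabilityMeasure (gaussianVector d) := by unfold gaussianVector; infer_instance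
  have h := measurePreserving_pi (fun _ : Fin n => gaussianCoordinates d)
    (fun _ : Fin n => gaussianVector d) fun _ => measurePreserving_gaussianVector d
  set T : Set (Fin n → EuclideanSpace ℝ (Fin d)) :=
    {x | ∀ i j, i < j → τ ≤ s * (√(d : ℝ) * inner ℝ (x i) (x j))} with hT
  have hTm : MeasurableSet T := by
    simp only [hT, Set.ofPred_forall]
    exact MeasurableSet.iInter fun i => MeasurableSet.iInter fun j => MeasurableSet.iInter fun _ =>
      measurableSet_le measurable_const (by fun_prop)
  have hle : gaussianSample n d S ≤ gramProb n d (s / √d) fun _ _ => τ := by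
    refine (measure_mono (show S ⊆ T from fun x hx => hS x hx)).trans (le_of_eq ?_)
    rw [gaussianSample, ← h.measure_preimage hTm.nullMeasurableSet, gramProb]
    congr 1
    ext x
    simp only [hT, Set.mem_preimage, Set.mem_ofPred_eq, inner_smul_left, inner_smul_right]
    refine forall_congr' fun i => forall_congr' fun j => imp_congr_right fun _ => ?_
    rw [EuclideanSpace.inner_eq_star_dotProduct, dotProduct_comm]
    simp only [star_trivial, map_inv₀, conj_trivial]
    rw [show s * (√(d : ℝ) * ((√(d : ℝ))⁻¹ * ((√(d : ℝ))⁻¹ * (x i ⬝ᵥ x j)))) =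
      s / √(d : ℝ) * (x i ⬝ᵥ x j) by field_simp]
  exact ENNReal.toReal_mono ((gramProb_le_one _ _ _ _).trans_lt ENNReal.one_lt_top).ne hle

theorem redProb_le_gramProb {n d : ℕ} (hd : 1 ≤ d) (c : ℝ) :
    redProb n d c ≤ (gramProb n d (-1 / √d) fun _ _ => c).toReal := by
  have hR : 0 < √(d : ℝ) := Real.sqrt_pos.2 (by exact_mod_cast hd)
  refine gaussianSample_real_le_gramProb hd (-1) c fun x hx i j hij => ?_
  have h := hx (Set.mem_univ i) (Set.mem_univ j) hij.ne
  simp only [geometricGraph, not_and, not_le] at h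
  have h2 := h hij.ne
  rw [lt_div_iff₀ hR] at h2
  linarith

theorem blueProb_le_gramProb {n d : ℕ} (hd : 1 ≤ d) (c : ℝ) :
    blueProb n d c ≤ (gramProb n d (1 / √d) fun _ _ => -c).toReal := by
  have hR : 0 < √(d : ℝ) := Real.sqrt_pos.2 (by exact_mod_cast hd)
  refine gaussianSample_real_le_gramProb hd 1 (-c) fun x hx i j hij => ?_
  have h := hx (Set.mem_univ i) (Set.mem_univ j) hij.ne
  have h2 := h.2
  rw [div_le_iff₀ hR] at h2
  linarith

theorem gaussianTail_neg (c : ℝ) :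
    gaussianTail (-c) = 1 - (gaussianReal 0 1).real (Set.Iic (-c)) := by
  have : NullSingletonClass (gaussianReal 0 1) := nullSingletonClass_gaussianReal one_ne_zero
  rw [gaussianTail, ← probReal_compl_eq_one_sub measurableSet_Iic, Set.compl_Iic]
  exact measureReal_congr Ioi_ae_eq_Ici.symm

theorem gaussianTail_eq_Iic (c : ℝ) :
    gaussianTail c = (gaussianReal 0 1).real (Set.Iic (-c)) := by
  have h : (gaussianReal 0 1).map (fun x => -x) = gaussianReal 0 1 := by
    rw [gaussianReal_map_neg, neg_zero]
  rw [gaussianTail, ← h, map_measureReal_apply measurable_neg measurableSet_Ici, h]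
  congr 1
  ext x
  simp

theorem gaussianTail_injective : Function.Injective gaussianTail := by
  refine (strictAnti_of_deriv_neg fun t => ?_).injective
  rw [(hasDerivAt_gaussianTail t).deriv]
  exact neg_neg_of_pos (gaussianPDFReal_pos 0 1 t one_ne_zero)

theorem pow_three_le_mul_choose_three {r : ℕ} (hr : 4 ≤ r) : r ^ 3 ≤ 16 * r.choose 3 := by
  induction r, hr using Nat.le_induction with
  | base => decide
  | succ n hn ih =>
    have h2 : 2 * n.choose 2 + n = n ^ 2 := by
      have h := Nat.choose_two_right n
      have h' := Nat.even_mul_pred_self n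
      obtain ⟨k, hk⟩ := h'
      obtain ⟨m, rfl⟩ : ∃ m, n = m + 1 := ⟨n - 1, by omega⟩
      simp only [Nat.add_sub_cancel] at h hk
      rw [h, hk]
      have : (k + k) / 2 = k := by omega
      rw [this]
      nlinarith
    rw [Nat.choose_succ_succ]
    nlinarith

/-- The errors of order `r² / √d` and `r⁴ / d` are at most a `K / D` fraction of the triangle
term, once `D ≤ r` and `√d` is at least of order `D r`. -/
theorem error_le_fraction_choose_three {B κ A D R : ℝ} {r : ℕ} (hB : 0 < B) (hκ : 0 < κ)
    (hD : 0 < D) (hR : 0 < R) (hr : 4 ≤ r) (hDr : D ≤ r) (hA : D * r ≤ A * R) :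
    B * (r ^ 2 / R + r ^ 4 / R ^ 2) ≤
      κ ^ 3 / R * r.choose 3 * (16 * B * (1 + A) / κ ^ 3 / D) := by
  have hc : (r : ℝ) ^ 3 ≤ 16 * r.choose 3 := by exact_mod_cast pow_three_le_mul_choose_three hr
  have hr0 : (0 : ℝ) < r := by exact_mod_cast (by omega : 0 < r)
  have hA0 : 0 ≤ A := by
    by_contra hneg
    push Not at hneg
    nlinarith [mul_pos hD hr0, mul_neg_of_neg_of_pos hneg hR]
  have h1 : (r : ℝ) ^ 2 / R ≤ r ^ 3 / (R * D) := by
    rw [div_le_div_iff₀ hR (by positivity)]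
    have : 0 ≤ (r : ℝ) ^ 2 * R := by positivity
    nlinarith
  have h2 : (r : ℝ) ^ 4 / R ^ 2 ≤ A * (r ^ 3 / (R * D)) := by
    rw [mul_div_assoc', div_le_div_iff₀ (by positivity) (by positivity)]
    have : 0 ≤ (r : ℝ) ^ 3 * R := by positivity
    nlinarith
  calc B * ((r : ℝ) ^ 2 / R + r ^ 4 / R ^ 2) ≤ B * ((1 + A) * (r ^ 3 / (R * D))) := by
        refine mul_le_mul_of_nonneg_left ?_ hB.le
        linarith
    _ ≤ B * ((1 + A) * (16 * r.choose 3 / (R * D))) := by gcongr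
    _ = _ := by field_simp

/-- The bound of `exists_gramProb_const_le`, with the error absorbed into the triangle term. -/
theorem exists_gramProb_const_le_triangle (τ A : ℝ) : ∃ K : ℝ, ∀ (σ D : ℝ) (r d : ℕ),
    (σ = 1 ∨ σ = -1) → 1 ≤ d → 0 < D → 4 ≤ r → D ≤ r → D * r ≤ A * √(d : ℝ) →
    (gramProb r d (σ / √d) fun _ _ => τ).toReal ≤ gaussianTail τ ^ r.choose 2 *
      Real.exp (gaussianHazard τ ^ 3 / √(d : ℝ) * r.choose 3 * (σ + K / D)) := by
  obtain ⟨B, hB, h⟩ := exists_gramProb_const_le τ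
  have hκ := gaussianHazard_pos τ
  have hq := gaussianTail_pos τ
  refine ⟨16 * B * (1 + A) / gaussianHazard τ ^ 3, fun σ D r d hσ hd hD hr hDr hA => ?_⟩
  have hd0 : (0 : ℝ) < d := by exact_mod_cast hd
  refine (ENNReal.toReal_mono ENNReal.ofReal_ne_top (h σ hσ r d hd)).trans ?_
  rw [ENNReal.toReal_ofReal (by positivity)]
  refine mul_le_mul_of_nonneg_left (Real.exp_le_exp.2 ?_) (by positivity)
  have he := error_le_fraction_choose_three hB hκ hD (Real.sqrt_pos.2 hd0) hr hDr hA
  rw [Real.sq_sqrt hd0.le] at he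
  rw [mul_add (_ * _) σ]
  refine add_le_add (le_of_eq ?_) he
  ring

theorem proposition2 :
    ∃ (D₀ : ℝ → ℝ) (ℓ₀ : ℝ → ℝ → ℕ) (Kred : ℝ → ℝ) (Kblue : ℝ → ℝ → ℝ),
      ∀ (C p c a D : ℝ) (ℓ d : ℕ),
        1 < C → 0 < p → p < 1 / 2 →
        -- `c = c_p` is the number with `ℙ[Z ≤ -c] = p` for a standard Gaussian `Z`
        0 < c → (gaussianReal 0 1).real (Set.Iic (-c)) = p →
        a = Real.exp (-c ^ 2 / 2) / √(2 * Real.pi) →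
        D₀ C ≤ D → ℓ₀ C D ≤ ℓ → D ^ 2 * (ℓ : ℝ) ^ 2 ≤ (d : ℝ) →
        redProb ℓ d c ≤
          p ^ (ℓ.choose 2) *
            Real.exp (-(a ^ 3 / (p ^ 3 * √(d : ℝ)) * (ℓ.choose 3 : ℝ) * (1 - Kred p / D))) ∧
        -- `r` is `C ℓ`, rounded in either direction when it is not an integer
        ∀ r : ℕ, |(r : ℝ) - C * ℓ| < 1 →
          blueProb r d c ≤
            (1 - p) ^ (r.choose 2) *
              Real.exp (a ^ 3 / ((1 - p) ^ 3 * √(d : ℝ)) * (r.choose 3 : ℝ) *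
                (1 + Kblue p C / D)) := by
  choose K hK using exists_gramProb_const_le_triangle
  -- a right inverse of the Gaussian tail, turning `p` into `c_p`
  set g := Function.invFun gaussianTail with hg
  have hginv : ∀ c, g (gaussianTail c) = c := Function.leftInverse_invFun gaussianTail_injective
  refine ⟨fun _ => 1, fun _ D => ⌈D⌉₊ + 5, fun p => K (g p) 1, fun p C => K (-g p) (2 * C), ?_⟩
  intro C p c a D ℓ d hC hp hp2 hc hcp ha hD hℓ hd
  have hD : 1 ≤ D := hD
  have htail : gaussianTail c = p := (gaussianTail_eq_Iic c).trans hcp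
  have htail' : gaussianTail (-c) = 1 - p := by rw [gaussianTail_neg, hcp]
  have hpdf : gaussianPDFReal 0 1 c = a := by
    rw [gaussianPDFReal_zero_one, ha, inv_mul_eq_div]
  have hpdf' : gaussianPDFReal 0 1 (-c) = a := by
    rw [gaussianPDFReal_zero_one, ha, inv_mul_eq_div, neg_sq]
  have hgp : g p = c := by rw [← htail, hginv]
  have hℓD : D + 5 ≤ ℓ := by
    have h : ((⌈D⌉₊ + 5 : ℕ) : ℝ) ≤ ℓ := by exact_mod_cast hℓ
    push_cast at h
    linarith [Nat.le_ceil D]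
  have hDℓ : D * ℓ ≤ √(d : ℝ) := Real.le_sqrt_of_sq_le (by rw [mul_pow]; exact hd)
  have hd1 : 1 ≤ d := by
    have h1 : 1 ≤ D * ℓ := by nlinarith
    have : (1 : ℝ) ≤ d := (one_le_pow₀ h1 (n := 2)).trans (by rwa [mul_pow])
    exact_mod_cast this
  refine ⟨?_, fun r hr => ?_⟩
  · have h4 : 4 ≤ ℓ := by
      have : (4 : ℝ) ≤ ℓ := by linarith
      exact_mod_cast this
    refine (redProb_le_gramProb hd1 c).trans ((hK c 1 (-1) D ℓ d (Or.inr rfl) hd1 (by linarith) h4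
      (by linarith) (by linarith)).trans_eq ?_)
    rw [gaussianHazard, hpdf, htail]
    simp only [hgp]
    congr 2
    rw [div_pow, div_div]
    ring
  · obtain ⟨hr1, hr2⟩ := abs_lt.1 hr
    have hCℓ : (ℓ : ℝ) ≤ C * ℓ := le_mul_of_one_le_left (Nat.cast_nonneg ℓ) hC.le
    have h4 : 4 ≤ r := by
      have : (4 : ℝ) ≤ r := by linarith
      exact_mod_cast this
    have hDr : D * r ≤ 2 * C * √(d : ℝ) := by
      have h1 : (r : ℝ) ≤ 2 * (C * ℓ) := by linarith
      nlinarith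
    refine (blueProb_le_gramProb hd1 c).trans ((hK (-c) (2 * C) 1 D r d (Or.inl rfl) hd1
      (by linarith) h4 (by linarith) hDr).trans_eq ?_)
    rw [gaussianHazard, hpdf', htail']
    simp only [hgp]
    rw [div_pow, div_div]
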